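/- **Setting.** For $z\in\{L,C,R\}$ let $$H^z(x,y)=\tfrac{b_z}{2}y^2-\tfrac{c_z}{2}x^2+a_zxy+\alpha_zy-\beta_zx$$ with real coefficients, and let $f_z,g_z$ be real affine functions of $(x,y)$. Consider for small $\epsilon\ge 0$ the piecewise linear system $$\dot x=H_y+\epsilon f,\qquad \dot y=-H_x+\epsilon g, \tag{1}$$ where $(H,f,g)=(H^L,f_L,g_L)$ in the left zone $x\le-1$, $(H^C,f_C,g_C)$ in the central zone $-1\le x\le1$ and $(H^R,f_R,g_R)$ in the right zone $x\ge1$. A point of a switching line $x=\pm1$ is a *crossing point* if the first components of the two adjacent fields have positive product there, and a *tangent point* if one of them vanishes. An *arc* in a zone is an orbit arc of the subsystem of that zone which lies, except for its end points, in the interior of the zone. A *crossing periodic orbit* is a closed chain of finitely many arcs joined at crossing points of the switching lines; a *limit cycle* is a crossing periodic orbit that is isolated among the periodic orbits, i.e. among the crossing ones and the non-constant periodic orbits of a subsystem that stay in its closed zone. **Hypotheses** on (1) with $\epsilon=0$. (H1) The central subsystem has a saddle in $-1<x<1$; each of the other two subsystems has a saddle or a center (anywhere in the plane). (H2) Every point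 of the lines $x=\pm1$ is a crossing point or a tangent point. (H3) There are three periodic annuli of clockwise crossing periodic orbits $L^i_h$, $h\in J_i$, $i=0,1,2$, where $J_i$ is a non-empty open (possibly unbounded) interval: * $L^0_h=\widehat{AA_1}\cup\widehat{A_1A_2}\cup\widehat{A_2A_3}\cup\widehat{A_3A}$ with $A=(1,a(h))$, $A_1=(1,a_1(h))$, $A_2=(-1,a_2(h))$, $A_3=(-1,a_3(h))$, $a_1(h)<a(h)$, $a_2(h)<a_3(h)$; the arcs are run through in this order and lie in the right, central, left and central zone; * $L^1_h=\widehat{BB_1}\cup\widehat{B_1B}$ with $B=(1,b(h))$, $B_1=(1,b_1(h))$, $b_1(h)<b(h)$, with arcs in the right and the central zone; * $L^2_h=\widehat{CC_1}\cup\widehat{C_1C}$ with $C=(-1,c(h))$, $C_1=(-1,c_1(h))$, $c_1(h)<c(h)$, with arcs in the central and the left zone. All these points are crossing points, and $a,b,c$ are injective and differentiable functions of $h$. **Poincaré maps.** Starting at $A(h)$, follow the orbit of (1) through the right, central, left and central zone, each time up to the first point on the switching lines, to the point $A_\epsilon(h)$ on $x=1$. Likewise, $B_\epsilon(h)$ is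 reached from $B(h)$ through the right and then the central zone, and $C_\epsilon(h)$ from $C(h)$ through the central and then the left zone. The first order Melnikov functions $M_0,M_1,M_2$ are defined by $$H^R(A_\epsilon(h))-H^R(A(h))=\epsilon M_0(h)+O(\epsilon^2),\qquad H^R(B_\epsilon(h))-H^R(B(h))=\epsilon M_1(h)+O(\epsilon^2),$$ $$H^C(C_\epsilon(h))-H^C(C(h))=\epsilon M_2(h)+O(\epsilon^2)\qquad(\epsilon\to0^+).$$ **Theorem.** Assume (H1), (H2), (H3). For each $h\in J_0$ (resp. $J_1$, $J_2$) the point $A_\epsilon(h)$ (resp. $B_\epsilon(h)$, $C_\epsilon(h)$) exists for all sufficiently small $\epsilon\ge0$, the above expansions hold, and $$M_0(h)=\frac{H^R_y(A)}{H^C_y(A)}I^0_C+\frac{H^R_y(A)H^C_y(A_3)}{H^C_y(A)H^L_y(A_3)}I^0_L+\frac{H^R_y(A)H^C_y(A_3)H^L_y(A_2)}{H^C_y(A)H^L_y(A_3)H^C_y(A_2)}\bar I^0_C+\frac{H^R_y(A)H^C_y(A_3)H^L_y(A_2)H^C_y(A_1)}{H^C_y(A)H^L_y(A_3)H^C_y(A_2)H^R_y(A_1)}I^0_R,$$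 $$M_1(h)=\frac{H^R_y(B)}{H^C_y(B)}I^1_C+\frac{H^R_y(B)H^C_y(B_1)}{H^C_y(B)H^R_y(B_1)}I^1_R,\qquad M_2(h)=\frac{H^C_y(C)}{H^L_y(C)}I^2_L+\frac{H^C_y(C)H^L_y(C_1)}{H^L_y(C)H^C_y(C_1)}I^2_C,$$ where $$I^0_C=\int_{\widehat{A_3A}}g_Cdx-f_Cdy,\quad I^0_L=\int_{\widehat{A_2A_3}}g_Ldx-f_Ldy,\quad \bar I^0_C=\int_{\widehat{A_1A_2}}g_Cdx-f_Cdy,\quad I^0_R=\int_{\widehat{AA_1}}g_Rdx-f_Rdy,$$ $$I^1_C=\int_{\widehat{B_1B}}g_Cdx-f_Cdy,\quad I^1_R=\int_{\widehat{BB_1}}g_Rdx-f_Rdy,\quad I^2_L=\int_{\widehat{C_1C}}g_Ldx-f_Ldy,\quad I^2_C=\int_{\widehat{CC_1}}g_Cdx-f_Cdy.$$ Furthermore, if for some $i\in\{0,1,2\}$ the function $M_i$ has a simple zero $h^*\in J_i$ (that is, $M_i(h^*)=0\ne M_i'(h^*)$), then for all sufficiently small $\epsilon>0$ system (1) has a unique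 limit cycle near $L^i_{h^*}$: there is a neighbourhood $U_0$ of $L^i_{h^*}$ such that for every neighbourhood $U$ of $L^i_{h^*}$ there is $\epsilon_0>0$ such that, for $0<\epsilon<\epsilon_0$, system (1) has exactly one periodic orbit contained in $U_0$, and this orbit is a limit cycle contained in $U$. -/

import Mathlib

open Set Filter Topology

namespace PWHam

/-- The left (`x ≤ -1`), central (`-1 ≤ x ≤ 1`) and right (`1 ≤ x`) zones. -/
inductive Zone
  | L
  | C
  | R

/-- The open region of a zone. -/
def Zone.region : Zone → Set (ℝ × ℝ)
  | Zone.L => {p | p.1 < -1}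
  | Zone.C => {p | -1 < p.1 ∧ p.1 < 1}
  | Zone.R => {p | 1 < p.1}

/-- Coefficients of `H(x,y) = (b/2) y² - (c/2) x² + a x y + α y - β x`. -/
structure Ham where
  a : ℝ
  b : ℝ
  c : ℝ
  α : ℝ
  β : ℝ

namespace Ham

noncomputable def val (H : Ham) (p : ℝ × ℝ) : ℝ :=
  H.b / 2 * p.2 ^ 2 - H.c / 2 * p.1 ^ 2 + H.a * p.1 * p.2 + H.α * p.2 - H.β * p.1

/-- The partial derivative `H_x`. -/
def dx (H : Ham) (p : ℝ × ℝ) : ℝ := -H.c * p.1 + H.a * p.2 - H.β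

/-- The partial derivative `H_y`. -/
def dy (H : Ham) (p : ℝ × ℝ) : ℝ := H.b * p.2 + H.a * p.1 + H.α

theorem hasDerivAt_dx (H : Ham) (x y : ℝ) :
    HasDerivAt (fun s => H.val (s, y)) (H.dx (x, y)) x := by
  have h := (((((hasDerivAt_id' x).pow 2).const_mul (H.c / 2)).const_sub (H.b / 2 * y ^ 2)).add
    (((hasDerivAt_id' x).const_mul H.a).mul_const y)).add_const (H.α * y)
  refine (h.sub ((hasDerivAt_id' x).const_mul H.β)).congr_deriv ?_
  simp only [dx]
  ring

theorem hasDerivAt_dy (H : Ham) (x y : ℝ) :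
    HasDerivAt (fun s => H.val (x, s)) (H.dy (x, y)) y := by
  have h := (((((hasDerivAt_id' y).pow 2).const_mul (H.b / 2)).sub_const (H.c / 2 * x ^ 2)).add
    ((hasDerivAt_id' y).const_mul (H.a * x))).add ((hasDerivAt_id' y).const_mul H.α)
  refine (h.sub_const (H.β * x)).congr_deriv ?_
  simp only [dy]
  ring

/-- The matrix of the linear part of the Hamiltonian field `(H_y, -H_x)`. -/
def jac (H : Ham) : Matrix (Fin 2) (Fin 2) ℝ := !![H.a, H.b; H.c, -H.a]

/-- `p` is a saddle of the field `(H_y, -H_x)`. -/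
def IsSaddle (H : Ham) (p : ℝ × ℝ) : Prop :=
  H.dy p = 0 ∧ H.dx p = 0 ∧ ∃ l < (0 : ℝ), ∃ m > (0 : ℝ),
    Module.End.HasEigenvalue (Matrix.toLin' H.jac) l ∧
    Module.End.HasEigenvalue (Matrix.toLin' H.jac) m

/-- `p` is a center of the (linear) field `(H_y, -H_x)`: the eigenvalues are `± i ω`, `ω > 0`. -/
def IsCenter (H : Ham) (p : ℝ × ℝ) : Prop :=
  H.dy p = 0 ∧ H.dx p = 0 ∧ ∃ w > (0 : ℝ),
    Module.End.HasEigenvalue (Matrix.toLin' (H.jac.map Complex.ofReal)) ((w : ℂ) * Complex.I)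

end Ham

/-- Coefficients of the affine function `c10 x + c01 y + c00`. -/
structure Aff where
  c10 : ℝ
  c01 : ℝ
  c00 : ℝ

def Aff.val (F : Aff) (p : ℝ × ℝ) : ℝ := F.c10 * p.1 + F.c01 * p.2 + F.c00

/-- The data of a piecewise linear near-Hamiltonian system with three zones:
`x' = H_y + ε f`, `y' = -H_x + ε g`, with a separate `H`, `f`, `g` in each zone. -/
structure Sys where
  H : Zone → Ham
  f : Zone → Aff
  g : Zone → Aff

namespace Sys

/-- The vector field of the subsystem of the zone `z`. -/
def field (S : Sys) (ε : ℝ) (z : Zone) (p : ℝ × ℝ) : ℝ × ℝ :=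
  ((S.H z).dy p + ε * (S.f z).val p, -(S.H z).dx p + ε * (S.g z).val p)

/-- `γ` is a solution of the (linear, hence complete) subsystem of the zone `z`. -/
def IsSolution (S : Sys) (ε : ℝ) (z : Zone) (γ : ℝ → ℝ × ℝ) : Prop :=
  ∀ t, HasDerivAt γ (S.field ε z (γ t)) t

/-- `p` lies on a switching line and the two adjacent fields cross the line there in the
same direction. -/
def IsCrossing (S : Sys) (ε : ℝ) (p : ℝ × ℝ) : Prop :=
  (p.1 = 1 ∧ 0 < (S.field ε Zone.C p).1 * (S.field ε Zone.R p).1) ∨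
  (p.1 = -1 ∧ 0 < (S.field ε Zone.L p).1 * (S.field ε Zone.C p).1)

/-- `p` lies on a switching line and one of the two adjacent fields is tangent to it there. -/
def IsTangent (S : Sys) (ε : ℝ) (p : ℝ × ℝ) : Prop :=
  (p.1 = 1 ∧ ((S.field ε Zone.C p).1 = 0 ∨ (S.field ε Zone.R p).1 = 0)) ∨
  (p.1 = -1 ∧ ((S.field ε Zone.L p).1 = 0 ∨ (S.field ε Zone.C p).1 = 0))

/-- `γ`, on `[0, T]`, is an orbit arc of the subsystem of the zone `z` from `p` to `q` which
lies in the open zone in between. If `p` and `q` are on the switching lines, `q` is thus the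
first point, after `p`, where the orbit meets them. -/
structure IsArc (S : Sys) (ε : ℝ) (z : Zone) (p q : ℝ × ℝ) (γ : ℝ → ℝ × ℝ) (T : ℝ) :
    Prop where
  pos : 0 < T
  sol : S.IsSolution ε z γ
  init : γ 0 = p
  term : γ T = q
  inside : ∀ t ∈ Ioo 0 T, γ t ∈ z.region

def Connects (S : Sys) (ε : ℝ) (z : Zone) (p q : ℝ × ℝ) : Prop :=
  ∃ γ T, S.IsArc ε z p q γ T

/-- `Γ` is a crossing periodic orbit: a closed chain of finitely many arcs that are joined at
crossing points of the switching lines. -/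
def IsCrossingPeriodicOrbit (S : Sys) (ε : ℝ) (Γ : Set (ℝ × ℝ)) : Prop :=
  ∃ (n : ℕ) (z : ℕ → Zone) (p : ℕ → ℝ × ℝ) (γ : ℕ → ℝ → ℝ × ℝ) (T : ℕ → ℝ),
    0 < n ∧ p n = p 0 ∧
    (∀ i < n, S.IsCrossing ε (p i) ∧ S.IsArc ε (z i) (p i) (p (i + 1)) (γ i) (T i)) ∧
    Γ = ⋃ i ∈ Iio n, γ i '' Icc 0 (T i)

/-- `Γ` is a periodic orbit, not an equilibrium, of one subsystem which stays in its zone. -/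
def IsOneZonePeriodicOrbit (S : Sys) (ε : ℝ) (Γ : Set (ℝ × ℝ)) : Prop :=
  ∃ (z : Zone) (γ : ℝ → ℝ × ℝ) (T : ℝ), 0 < T ∧ S.IsSolution ε z γ ∧
    Function.Periodic γ T ∧ S.field ε z (γ 0) ≠ 0 ∧
    (∀ t, γ t ∈ closure z.region) ∧ Γ = range γ

def IsPeriodicOrbit (S : Sys) (ε : ℝ) (Γ : Set (ℝ × ℝ)) : Prop :=
  S.IsCrossingPeriodicOrbit ε Γ ∨ S.IsOneZonePeriodicOrbit ε Γ

/-- A crossing limit cycle: a crossing periodic orbit that is isolated among the periodic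
orbits. -/
def IsLimitCycle (S : Sys) (ε : ℝ) (Γ : Set (ℝ × ℝ)) : Prop :=
  S.IsCrossingPeriodicOrbit ε Γ ∧
    ∃ V : Set (ℝ × ℝ), IsOpen V ∧ Γ ⊆ V ∧
      ∀ Γ' ⊆ V, S.IsPeriodicOrbit ε Γ' → Γ' = Γ

/-- For small `ε > 0` the system has a unique limit cycle near `L`: some fixed neighbourhood
`U₀` of `L` contains exactly one limit cycle (and no other periodic orbit), and this limit cycle
lies in any prescribed neighbourhood `U` of `L` once `ε` is small enough. -/
def UniqueLimitCycleNear (S : Sys) (L : Set (ℝ × ℝ)) : Prop :=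
  ∃ U₀ : Set (ℝ × ℝ), IsOpen U₀ ∧ L ⊆ U₀ ∧
    ∀ U : Set (ℝ × ℝ), IsOpen U → L ⊆ U →
      ∃ ε₀ > 0, ∀ ε ∈ Ioo 0 ε₀, ∃ Γ : Set (ℝ × ℝ), Γ ⊆ U₀ ∧ Γ ⊆ U ∧
        S.IsLimitCycle ε Γ ∧ ∀ Γ' ⊆ U₀, S.IsPeriodicOrbit ε Γ' → Γ' = Γ

/-- Hypothesis (H1). -/
def H1 (S : Sys) : Prop :=
  (∃ p ∈ Zone.C.region, (S.H Zone.C).IsSaddle p) ∧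
  (∃ p, (S.H Zone.L).IsSaddle p ∨ (S.H Zone.L).IsCenter p) ∧
  (∃ p, (S.H Zone.R).IsSaddle p ∨ (S.H Zone.R).IsCenter p)

/-- Hypothesis (H2). -/
def H2 (S : Sys) : Prop :=
  ∀ p : ℝ × ℝ, p.1 = 1 ∨ p.1 = -1 → S.IsCrossing 0 p ∨ S.IsTangent 0 p

/-- The line integral `∫ g_z dx - f_z dy` along `γ` restricted to `[0, T]`. -/
noncomputable def lineInt (S : Sys) (z : Zone) (γ : ℝ → ℝ × ℝ) (T : ℝ) : ℝ :=
  ∫ t in (0 : ℝ)..T, ((S.g z).val (γ t) * deriv (fun s => (γ s).1) t -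
    (S.f z).val (γ t) * deriv (fun s => (γ s).2) t)

/-- The Poincaré map through three zones takes `(1, y)` to `(1, y')`: the orbit of the
`ε`-system from `(1, y)` passes through the right, central, left and central zones, in this
order, and arrives at `(1, y')`. -/
def Ret0 (S : Sys) (ε y y' : ℝ) : Prop :=
  ∃ y₁ y₂ y₃ : ℝ, S.Connects ε Zone.R (1, y) (1, y₁) ∧ S.Connects ε Zone.C (1, y₁) (-1, y₂) ∧
    S.Connects ε Zone.L (-1, y₂) (-1, y₃) ∧ S.Connects ε Zone.C (-1, y₃) (1, y')

/-- The return from `(1, y)` through the right and then the central zone to `(1, y')`. -/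
def Ret1 (S : Sys) (ε y y' : ℝ) : Prop :=
  ∃ y₁ : ℝ, S.Connects ε Zone.R (1, y) (1, y₁) ∧ S.Connects ε Zone.C (1, y₁) (1, y')

/-- The return from `(-1, y)` through the central and then the left zone to `(-1, y')`. -/
def Ret2 (S : Sys) (ε y y' : ℝ) : Prop :=
  ∃ y₁ : ℝ, S.Connects ε Zone.C (-1, y) (-1, y₁) ∧ S.Connects ε Zone.L (-1, y₁) (-1, y')

/-- `M` is the first order Melnikov function, on `J`, of the Poincaré map `ret` of the line
`x = x₀`, with starting points `(x₀, a h)` and with the displacement measured by `K`: for each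
`h ∈ J` the Poincaré map is defined at `(x₀, a h)` for all small `ε ≥ 0` and, with `P ε` the
ordinate of the image, `K (x₀, P ε) - K (x₀, a h) = ε M(h) + O(ε²)`. -/
def IsMelnikov (K : Ham) (x₀ : ℝ) (ret : ℝ → ℝ → ℝ → Prop) (J : Set ℝ) (a M : ℝ → ℝ) : Prop :=
  ∀ h ∈ J, ∃ ε₀ > 0, ∃ P : ℝ → ℝ, (∀ ε ∈ Ico 0 ε₀, ret ε (a h) (P ε)) ∧
    (fun ε : ℝ => K.val (x₀, P ε) - K.val (x₀, a h) - ε * M h)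
      =O[𝓝[≥] 0] (fun ε : ℝ => ε ^ 2)

end Sys

/-- A periodic annulus of the unperturbed system made of clockwise crossing periodic orbits
through three zones, parametrized by `h` in an open interval `J`. The orbit of `h` runs through
`A = (1, a h)`, `A₁ = (1, a₁ h)`, `A₂ = (-1, a₂ h)`, `A₃ = (-1, a₃ h)` and consists of the
arcs `γR` from `A` to `A₁`, `γB` from `A₁` to `A₂`, `γL` from `A₂` to `A₃` and `γC` from `A₃`
to `A`. -/
structure Annulus0 (S : Sys) where
  J : Set ℝ
  isOpen : IsOpen J
  interval : J.OrdConnected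
  nonempty : J.Nonempty
  (a a₁ a₂ a₃ : ℝ → ℝ)
  diff : DifferentiableOn ℝ a J
  inj : InjOn a J
  (γR γB γL γC : ℝ → ℝ → ℝ × ℝ)
  (TR TB TL TC : ℝ → ℝ)
  lt_right : ∀ h ∈ J, a₁ h < a h
  lt_left : ∀ h ∈ J, a₂ h < a₃ h
  cross : ∀ h ∈ J, S.IsCrossing 0 (1, a h)
  cross₁ : ∀ h ∈ J, S.IsCrossing 0 (1, a₁ h)
  cross₂ : ∀ h ∈ J, S.IsCrossing 0 (-1, a₂ h)
  cross₃ : ∀ h ∈ J, S.IsCrossing 0 (-1, a₃ h)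
  arcR : ∀ h ∈ J, S.IsArc 0 Zone.R (1, a h) (1, a₁ h) (γR h) (TR h)
  arcB : ∀ h ∈ J, S.IsArc 0 Zone.C (1, a₁ h) (-1, a₂ h) (γB h) (TB h)
  arcL : ∀ h ∈ J, S.IsArc 0 Zone.L (-1, a₂ h) (-1, a₃ h) (γL h) (TL h)
  arcC : ∀ h ∈ J, S.IsArc 0 Zone.C (-1, a₃ h) (1, a h) (γC h) (TC h)

/-- A periodic annulus of the unperturbed system made of clockwise crossing periodic orbits
through the right and central zones: the orbit of `h` consists of the arcs `γR` from
`B = (1, b h)` to `B₁ = (1, b₁ h)` and `γC` from `B₁` to `B`. -/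
structure Annulus1 (S : Sys) where
  J : Set ℝ
  isOpen : IsOpen J
  interval : J.OrdConnected
  nonempty : J.Nonempty
  (b b₁ : ℝ → ℝ)
  diff : DifferentiableOn ℝ b J
  inj : InjOn b J
  (γR γC : ℝ → ℝ → ℝ × ℝ)
  (TR TC : ℝ → ℝ)
  lt : ∀ h ∈ J, b₁ h < b h
  cross : ∀ h ∈ J, S.IsCrossing 0 (1, b h)
  cross₁ : ∀ h ∈ J, S.IsCrossing 0 (1, b₁ h)
  arcR : ∀ h ∈ J, S.IsArc 0 Zone.R (1, b h) (1, b₁ h) (γR h) (TR h)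
  arcC : ∀ h ∈ J, S.IsArc 0 Zone.C (1, b₁ h) (1, b h) (γC h) (TC h)

/-- A periodic annulus of the unperturbed system made of clockwise crossing periodic orbits
through the central and left zones: the orbit of `h` consists of the arcs `γC` from
`C = (-1, c h)` to `C₁ = (-1, c₁ h)` and `γL` from `C₁` to `C`. -/
structure Annulus2 (S : Sys) where
  J : Set ℝ
  isOpen : IsOpen J
  interval : J.OrdConnected
  nonempty : J.Nonempty
  (c c₁ : ℝ → ℝ)
  diff : DifferentiableOn ℝ c J
  inj : InjOn c J
  (γC γL : ℝ → ℝ → ℝ × ℝ)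
  (TC TL : ℝ → ℝ)
  lt : ∀ h ∈ J, c₁ h < c h
  cross : ∀ h ∈ J, S.IsCrossing 0 (-1, c h)
  cross₁ : ∀ h ∈ J, S.IsCrossing 0 (-1, c₁ h)
  arcC : ∀ h ∈ J, S.IsArc 0 Zone.C (-1, c h) (-1, c₁ h) (γC h) (TC h)
  arcL : ∀ h ∈ J, S.IsArc 0 Zone.L (-1, c₁ h) (-1, c h) (γL h) (TL h)

namespace Annulus0

variable {S : Sys}

/-- The periodic orbit `L⁰_h`. -/
def orbit (D : Annulus0 S) (h : ℝ) : Set (ℝ × ℝ) :=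
  D.γR h '' Icc 0 (D.TR h) ∪ D.γB h '' Icc 0 (D.TB h) ∪
    D.γL h '' Icc 0 (D.TL h) ∪ D.γC h '' Icc 0 (D.TC h)

/-- The explicit expression of `M₀`. -/
noncomputable def M (D : Annulus0 S) (h : ℝ) : ℝ :=
  let A : ℝ × ℝ := (1, D.a h)
  let A₁ : ℝ × ℝ := (1, D.a₁ h)
  let A₂ : ℝ × ℝ := (-1, D.a₂ h)
  let A₃ : ℝ × ℝ := (-1, D.a₃ h)
  let HL := S.H Zone.L
  let HC := S.H Zone.C
  let HR := S.H Zone.R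
  HR.dy A / HC.dy A * S.lineInt Zone.C (D.γC h) (D.TC h) +
  (HR.dy A * HC.dy A₃) / (HC.dy A * HL.dy A₃) * S.lineInt Zone.L (D.γL h) (D.TL h) +
  (HR.dy A * HC.dy A₃ * HL.dy A₂) / (HC.dy A * HL.dy A₃ * HC.dy A₂) *
    S.lineInt Zone.C (D.γB h) (D.TB h) +
  (HR.dy A * HC.dy A₃ * HL.dy A₂ * HC.dy A₁) / (HC.dy A * HL.dy A₃ * HC.dy A₂ * HR.dy A₁) *
    S.lineInt Zone.R (D.γR h) (D.TR h)

end Annulus0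

namespace Annulus1

variable {S : Sys}

/-- The periodic orbit `L¹_h`. -/
def orbit (D : Annulus1 S) (h : ℝ) : Set (ℝ × ℝ) :=
  D.γR h '' Icc 0 (D.TR h) ∪ D.γC h '' Icc 0 (D.TC h)

/-- The explicit expression of `M₁`. -/
noncomputable def M (D : Annulus1 S) (h : ℝ) : ℝ :=
  let B : ℝ × ℝ := (1, D.b h)
  let B₁ : ℝ × ℝ := (1, D.b₁ h)
  let HC := S.H Zone.C
  let HR := S.H Zone.R
  HR.dy B / HC.dy B * S.lineInt Zone.C (D.γC h) (D.TC h) +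
  (HR.dy B * HC.dy B₁) / (HC.dy B * HR.dy B₁) * S.lineInt Zone.R (D.γR h) (D.TR h)

end Annulus1

namespace Annulus2

variable {S : Sys}

/-- The periodic orbit `L²_h`. -/
def orbit (D : Annulus2 S) (h : ℝ) : Set (ℝ × ℝ) :=
  D.γC h '' Icc 0 (D.TC h) ∪ D.γL h '' Icc 0 (D.TL h)

/-- The explicit expression of `M₂`. -/
noncomputable def M (D : Annulus2 S) (h : ℝ) : ℝ :=
  let P : ℝ × ℝ := (-1, D.c h)
  let P₁ : ℝ × ℝ := (-1, D.c₁ h)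
  let HL := S.H Zone.L
  let HC := S.H Zone.C
  HC.dy P / HL.dy P * S.lineInt Zone.L (D.γL h) (D.TL h) +
  (HC.dy P * HL.dy P₁) / (HL.dy P * HC.dy P₁) * S.lineInt Zone.C (D.γC h) (D.TC h)

end Annulus2

end PWHam

/-!
The energy `H^z` is constant along the arcs of the unperturbed system and changes by `ε` times the
work of the perturbation along those of the perturbed one. Differentiating this balance at the two
ends of an arc gives the first variation of the transition map between the switching lines, and
chaining these variations around a cycle gives the Melnikov function.

The displacement of the Poincaré map vanishes identically at `ε = 0`. Hence, by the intermediate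
value theorem and Rolle's theorem, near a simple zero of the Melnikov function it has exactly one
zero for each small `ε > 0`. A periodic orbit that stays near the unperturbed cycle meets the
switching lines only near the vertices of the cycle, so it follows its arcs, and it closes up after
one turn because the Poincaré map is increasing. It cannot stay in one closed zone, since the orbits
near a vertex cross the switching line.
-/

namespace PWHam

/-! ### Flows of affine fields -/

theorem hasDerivAt_fst_comp {E F : Type*} [NormedAddCommGroup E] [NormedSpace ℝ E]
    [NormedAddCommGroup F] [NormedSpace ℝ F] {u : ℝ → E × F} {u' : E × F} {t : ℝ}
    (h : HasDerivAt u u' t) : HasDerivAt (fun s => (u s).1) u'.1 t :=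
  (ContinuousLinearMap.fst ℝ E F).hasFDerivAt.comp_hasDerivAt t h

theorem hasDerivAt_snd_comp {E F : Type*} [NormedAddCommGroup E] [NormedSpace ℝ E]
    [NormedAddCommGroup F] [NormedSpace ℝ F] {u : ℝ → E × F} {u' : E × F} {t : ℝ}
    (h : HasDerivAt u u' t) : HasDerivAt (fun s => (u s).2) u'.2 t :=
  (ContinuousLinearMap.snd ℝ E F).hasFDerivAt.comp_hasDerivAt t h

section AffineFlow

variable {E : Type*} [NormedAddCommGroup E] [NormedSpace ℝ E]

/-- The linear field on `E × ℝ` that restricts to the affine field `v ↦ A v + b` on the slice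
`E × {1}`; it reduces affine flows to exponentials. -/
noncomputable def affineGen (A : E →L[ℝ] E) (b : E) : E × ℝ →L[ℝ] E × ℝ :=
  (ContinuousLinearMap.inl ℝ E ℝ).comp
    (A.comp (.fst ℝ E ℝ) + (ContinuousLinearMap.snd ℝ E ℝ).smulRight b)

theorem affineGen_apply (A : E →L[ℝ] E) (b : E) (w : E × ℝ) :
    affineGen A b w = (A w.1 + w.2 • b, 0) := by
  simp [affineGen]

theorem contDiff_affineGen {n : WithTop ℕ∞} :
    ContDiff ℝ n (fun q : (E →L[ℝ] E) × E => affineGen q.1 q.2) := by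
  have hA : ContDiff ℝ n (fun q : (E →L[ℝ] E) × E => q.1.comp (.fst ℝ E ℝ)) :=
    contDiff_fst.clm_comp contDiff_const
  have hb : ContDiff ℝ n
      (fun q : (E →L[ℝ] E) × E => (ContinuousLinearMap.snd ℝ E ℝ).smulRight q.2) :=
    (ContinuousLinearMap.smulRightL ℝ (E × ℝ) E (.snd ℝ E ℝ)).contDiff.comp contDiff_snd
  exact contDiff_const.clm_comp (hA.add hb)

/-- The flow of the affine field `v ↦ A v + b`. -/
noncomputable def affineFlow (A : E →L[ℝ] E) (b : E) (t : ℝ) (v : E) : E :=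
  (NormedSpace.exp (t • affineGen A b) (v, 1)).1

theorem affineFlow_zero (A : E →L[ℝ] E) (b v : E) : affineFlow A b 0 v = v := by
  simp [affineFlow]

variable [CompleteSpace E]

theorem hasDerivAt_exp_smul_affineGen (A : E →L[ℝ] E) (b : E) (w : E × ℝ) (t : ℝ) :
    HasDerivAt (fun t => NormedSpace.exp (t • affineGen A b) w)
      (affineGen A b (NormedSpace.exp (t • affineGen A b) w)) t :=
  ((hasDerivAt_exp_smul_const' (𝕂 := ℝ) (affineGen A b) t).clm_apply
    (hasDerivAt_const t w)).congr_deriv (by simp)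

theorem exp_smul_affineGen_snd (A : E →L[ℝ] E) (b : E) (w : E × ℝ) (t : ℝ) :
    (NormedSpace.exp (t • affineGen A b) w).2 = w.2 := by
  have hd (t : ℝ) : HasDerivAt (fun t => (NormedSpace.exp (t • affineGen A b) w).2) 0 t := by
    simpa only [affineGen_apply] using
      hasDerivAt_snd_comp (hasDerivAt_exp_smul_affineGen A b w t)
  simpa using is_const_of_deriv_eq_zero (fun t => (hd t).differentiableAt)
    (fun t => (hd t).deriv) t 0

theorem hasDerivAt_affineFlow (A : E →L[ℝ] E) (b v : E) (t : ℝ) :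
    HasDerivAt (fun t => affineFlow A b t v) (A (affineFlow A b t v) + b) t := by
  simpa only [affineFlow, affineGen_apply, exp_smul_affineGen_snd, one_smul] using
    hasDerivAt_fst_comp (hasDerivAt_exp_smul_affineGen A b (v, 1) t)

theorem affineFlow_apply_of_hasDerivAt {A : E →L[ℝ] E} {b : E} {γ : ℝ → E}
    (hγ : ∀ t, HasDerivAt γ (A (γ t) + b) t) (t s : ℝ) :
    affineFlow A b t (γ s) = γ (t + s) := by
  have hlip := A.lipschitz.add (LipschitzWith.const b)
  have heq : (fun t => affineFlow A b t (γ s)) = fun t => γ (t + s) :=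
    ODE_solution_unique_univ (v := fun _ v => A v + b) (s := fun _ => univ) (t₀ := 0)
      (fun _ => hlip.lipschitzOnWith)
      (fun t => ⟨hasDerivAt_affineFlow A b (γ s) t, mem_univ _⟩)
      (fun t => ⟨(hγ (t + s)).comp_add_const t s, mem_univ _⟩) (by simp [affineFlow_zero])
  exact congrFun heq t

theorem contDiff_affineFlow {n : WithTop ℕ∞} :
    ContDiff ℝ n
      (fun q : ((E →L[ℝ] E) × E) × ℝ × E => affineFlow q.1.1 q.1.2 q.2.1 q.2.2) := by
  have hexp : ContDiff ℝ n (NormedSpace.exp : (E × ℝ →L[ℝ] E × ℝ) → _) :=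
    contDiff_iff_contDiffAt.2 fun x => (NormedSpace.exp_analytic (𝕂 := ℝ) x).contDiffAt
  have hgen : ContDiff ℝ n
      (fun q : ((E →L[ℝ] E) × E) × ℝ × E => q.2.1 • affineGen q.1.1 q.1.2) :=
    contDiff_snd.fst.smul (contDiff_affineGen.comp contDiff_fst)
  exact ((hexp.comp hgen).clm_apply (contDiff_snd.snd.prodMk contDiff_const)).fst

end AffineFlow

/-! ### The flows of the subsystems -/

namespace Sys

variable {S : Sys} {ε : ℝ} {z : Zone} {γ : ℝ → ℝ × ℝ}

/-- The linear part of the affine field of the zone `z`. -/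
noncomputable def linPart (S : Sys) (ε : ℝ) (z : Zone) : ℝ × ℝ →L[ℝ] ℝ × ℝ :=
  (ContinuousLinearMap.fst ℝ ℝ ℝ).smulRight
      ((S.H z).a + ε * (S.f z).c10, (S.H z).c + ε * (S.g z).c10) +
    (ContinuousLinearMap.snd ℝ ℝ ℝ).smulRight
      ((S.H z).b + ε * (S.f z).c01, -(S.H z).a + ε * (S.g z).c01)

theorem field_eq_linPart_add (S : Sys) (ε : ℝ) (z : Zone) (p : ℝ × ℝ) :
    S.field ε z p = S.linPart ε z p + S.field ε z 0 := by
  ext <;> simp only [field, linPart, Ham.dx, Ham.dy, Aff.val, add_apply,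
    ContinuousLinearMap.smulRight_apply, ContinuousLinearMap.coe_fst',
    ContinuousLinearMap.coe_snd', Prod.smul_mk, Prod.mk_add_mk, smul_eq_mul, Prod.fst_zero,
    Prod.snd_zero] <;> ring

/-- The flow of the subsystem of the zone `z`. -/
noncomputable def flow (S : Sys) (ε : ℝ) (z : Zone) (t : ℝ) (p : ℝ × ℝ) : ℝ × ℝ :=
  affineFlow (S.linPart ε z) (S.field ε z 0) t p

theorem flow_zero (S : Sys) (ε : ℝ) (z : Zone) (p : ℝ × ℝ) : S.flow ε z 0 p = p :=
  affineFlow_zero _ _ p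

theorem isSolution_flow (S : Sys) (ε : ℝ) (z : Zone) (p : ℝ × ℝ) :
    S.IsSolution ε z (fun t => S.flow ε z t p) := fun t => by
  rw [field_eq_linPart_add]
  exact hasDerivAt_affineFlow _ _ p t

theorem IsSolution.flow_apply (hγ : S.IsSolution ε z γ) (t s : ℝ) :
    S.flow ε z t (γ s) = γ (t + s) :=
  affineFlow_apply_of_hasDerivAt (fun t => S.field_eq_linPart_add ε z (γ t) ▸ hγ t) t s

theorem IsSolution.eq_flow (hγ : S.IsSolution ε z γ) : γ = fun t => S.flow ε z t (γ 0) := by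
  simp only [hγ.flow_apply, add_zero]

theorem IsSolution.continuous (hγ : S.IsSolution ε z γ) : Continuous γ :=
  continuous_iff_continuousAt.2 fun t => (hγ t).continuousAt

theorem contDiff_flow (S : Sys) (z : Zone) {n : WithTop ℕ∞} :
    ContDiff ℝ n (fun q : ℝ × ℝ × (ℝ × ℝ) => S.flow q.1 z q.2.1 q.2.2) := by
  have hA : ContDiff ℝ n (fun ε => S.linPart ε z) :=
    ((ContinuousLinearMap.smulRightL ℝ (ℝ × ℝ) (ℝ × ℝ) (.fst ℝ ℝ ℝ)).contDiff.comp
      (by fun_prop)).add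
    ((ContinuousLinearMap.smulRightL ℝ (ℝ × ℝ) (ℝ × ℝ) (.snd ℝ ℝ ℝ)).contDiff.comp
      (by fun_prop))
  have hb : ContDiff ℝ n (fun ε => S.field ε z 0) := by
    unfold field
    fun_prop
  exact contDiff_affineFlow.comp
    (((hA.prodMk hb).comp contDiff_fst).prodMk contDiff_snd)

theorem continuous_flow (S : Sys) (z : Zone) :
    Continuous (fun q : ℝ × ℝ × (ℝ × ℝ) => S.flow q.1 z q.2.1 q.2.2) :=
  (S.contDiff_flow z (n := 0)).continuous

theorem continuous_field (S : Sys) (z : Zone) :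
    Continuous (fun q : ℝ × (ℝ × ℝ) => S.field q.1 z q.2) := by
  unfold field Ham.dx Ham.dy Aff.val
  fun_prop

end Sys

/-! ### Zones and their sides -/

theorem sub_mul_deriv_nonneg_of_forall_uIcc_le {f : ℝ → ℝ} {f' a b : ℝ}
    (hf : HasDerivAt f f' a) (hmin : ∀ t ∈ uIcc a b, f a ≤ f t) : 0 ≤ (b - a) * f' := by
  have hloc : IsLocalMinOn f (uIcc a b) a := IsMinOn.localize hmin
  simpa using hloc.hasFDerivWithinAt_nonneg hf.hasFDerivAt.hasFDerivWithinAt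
    (sub_mem_posTangentConeAt_of_segment_subset (segment_eq_uIcc a b).subset)

/-- The line of abscissa `x` bounds the zone `z`, which lies on the side of the line given by the
sign `σ`. -/
def Side (z : Zone) (x σ : ℝ) : Prop :=
  (z = Zone.R ∧ x = 1 ∧ σ = 1) ∨ (z = Zone.C ∧ x = 1 ∧ σ = -1) ∨
    (z = Zone.C ∧ x = -1 ∧ σ = 1) ∨ (z = Zone.L ∧ x = -1 ∧ σ = -1)

theorem isOpen_region (z : Zone) : IsOpen z.region := by
  cases z
  · exact isOpen_lt continuous_fst continuous_const
  · exact (isOpen_lt continuous_const continuous_fst).inter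
      (isOpen_lt continuous_fst continuous_const)
  · exact isOpen_lt continuous_const continuous_fst

theorem notMem_region_of_line {p : ℝ × ℝ} (hp : p.1 = 1 ∨ p.1 = -1) (z : Zone) :
    p ∉ z.region := by
  cases z <;> rcases hp with hp | hp <;> simp only [Zone.region, mem_ofPred_eq, hp] <;> norm_num

theorem eq_of_mem_region {z w : Zone} {p : ℝ × ℝ} (hz : p ∈ z.region) (hw : p ∈ w.region) :
    w = z := by
  cases z <;> cases w <;> simp only [Zone.region, mem_ofPred_eq] at hz hw <;>
    first | rfl | (exfalso; linarith)

theorem eq_of_mem_region_of_mem_closure {z w : Zone} {p : ℝ × ℝ} (hz : p ∈ z.region)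
    (hw : p ∈ closure w.region) : w = z :=
  let ⟨_, hqz, hqw⟩ := mem_closure_iff.1 hw _ (isOpen_region z) hz
  eq_of_mem_region hqz hqw

namespace Side

variable {z : Zone} {x σ : ℝ}

theorem sign_ne_zero (h : Side z x σ) : σ ≠ 0 := by
  rcases h with ⟨-, -, rfl⟩ | ⟨-, -, rfl⟩ | ⟨-, -, rfl⟩ | ⟨-, -, rfl⟩ <;> norm_num

theorem pos_of_mem (h : Side z x σ) {p : ℝ × ℝ} (hp : p ∈ z.region) : 0 < σ * (p.1 - x) := by
  rcases h with ⟨rfl, rfl, rfl⟩ | ⟨rfl, rfl, rfl⟩ | ⟨rfl, rfl, rfl⟩ | ⟨rfl, rfl, rfl⟩ <;>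
    simp only [Zone.region, mem_ofPred_eq] at hp <;> linarith

theorem nonneg_of_mem_closure (h : Side z x σ) {p : ℝ × ℝ} (hp : p ∈ closure z.region) :
    0 ≤ σ * (p.1 - x) :=
  closure_minimal (t := {p : ℝ × ℝ | 0 ≤ σ * (p.1 - x)}) (fun _ hq => (h.pos_of_mem hq).le)
    (isClosed_le (by fun_prop) (by fun_prop)) hp

theorem eventually_mem_region (h : Side z x σ) :
    ∀ᶠ s in 𝓝 x, 0 < σ * (s - x) → ∀ y, (s, y) ∈ z.region := by
  filter_upwards [eventually_lt_nhds (show x < x + 2 by linarith),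
    eventually_gt_nhds (show x - 2 < x by linarith)] with s hlt hgt hσ y
  rcases h with ⟨rfl, rfl, rfl⟩ | ⟨rfl, rfl, rfl⟩ | ⟨rfl, rfl, rfl⟩ | ⟨rfl, rfl, rfl⟩ <;>
    simp only [Zone.region, mem_ofPred_eq] <;> first | linarith | constructor <;> linarith

end Side

theorem exists_side {z : Zone} {p : ℝ × ℝ} (hp : p.1 = 1 ∨ p.1 = -1)
    (hz : p ∈ closure z.region) : ∃ σ, Side z p.1 σ := by
  cases z <;> rcases hp with hp | hp
  · have hside : Side Zone.L (-1) (-1) := by simp [Side]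
    linarith [hside.nonneg_of_mem_closure hz]
  · exact ⟨-1, by simp [Side, hp]⟩
  · exact ⟨-1, by simp [Side, hp]⟩
  · exact ⟨1, by simp [Side, hp]⟩
  · exact ⟨1, by simp [Side, hp]⟩
  · have hside : Side Zone.R 1 1 := by simp [Side]
    linarith [hside.nonneg_of_mem_closure hz]

namespace Sys

variable {S : Sys} {ε : ℝ} {z : Zone} {p q : ℝ × ℝ} {γ : ℝ → ℝ × ℝ} {T : ℝ}

theorem IsCrossing.fst_eq (h : S.IsCrossing ε p) : p.1 = 1 ∨ p.1 = -1 :=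
  h.imp And.left And.left

theorem IsCrossing.field_ne_zero (h : S.IsCrossing ε p) {σ : ℝ} (hz : Side z p.1 σ) :
    (S.field ε z p).1 ≠ 0 := by
  intro h0
  rcases h with ⟨hp, h⟩ | ⟨hp, h⟩ <;> rw [hp] at hz <;>
  rcases hz with ⟨rfl, hz, rfl⟩ | ⟨rfl, hz, rfl⟩ | ⟨rfl, hz, rfl⟩ | ⟨rfl, hz, rfl⟩ <;>
    first
    | (norm_num at hz; done)
    | (rw [h0] at h; simp at h)

theorem IsCrossing.zone_unique (h : S.IsCrossing ε p) {w : Zone} {σ ρ : ℝ}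
    (hz : Side z p.1 σ) (hw : Side w p.1 ρ) (hz' : 0 ≤ σ * (S.field ε z p).1)
    (hw' : 0 ≤ ρ * (S.field ε w p).1) : w = z := by
  rcases h with ⟨hp, h⟩ | ⟨hp, h⟩ <;> rw [hp] at hz hw <;>
  rcases hz with ⟨rfl, hz, rfl⟩ | ⟨rfl, hz, rfl⟩ | ⟨rfl, hz, rfl⟩ | ⟨rfl, hz, rfl⟩ <;>
  rcases hw with ⟨rfl, hw, rfl⟩ | ⟨rfl, hw, rfl⟩ | ⟨rfl, hw, rfl⟩ | ⟨rfl, hw, rfl⟩ <;>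
    first
    | rfl
    | (exfalso; norm_num at hz hw; done)
    | (exfalso; nlinarith)

/-- An orbit that crosses a switching line leaves every closed zone there: otherwise its abscissa
would have an extremum, hence a critical point, on the line. -/
theorem IsCrossing.exists_flow_notMem_closure (h : S.IsCrossing ε p) (z : Zone) :
    ∃ t, S.flow ε z t p ∉ closure z.region := by
  by_contra! hmem
  obtain ⟨σ, hσ⟩ := exists_side h.fst_eq (S.flow_zero ε z p ▸ hmem 0)
  have hd : HasDerivAt (fun t => σ * ((S.flow ε z t p).1 - p.1))
      (σ * (S.field ε z (S.flow ε z 0 p)).1) 0 :=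
    ((hasDerivAt_fst_comp (S.isSolution_flow ε z p 0)).sub_const p.1).const_mul σ
  have hmin : IsLocalMin (fun t => σ * ((S.flow ε z t p).1 - p.1)) 0 :=
    Eventually.of_forall fun t => by
      simpa [S.flow_zero] using hσ.nonneg_of_mem_closure (hmem t)
  have hzero := hmin.hasDerivAt_eq_zero hd
  rw [S.flow_zero] at hzero
  exact mul_ne_zero hσ.sign_ne_zero (h.field_ne_zero hσ) hzero

namespace IsArc

theorem mem_closure (h : S.IsArc ε z p q γ T) {t : ℝ} (ht : t ∈ Icc 0 T) :
    γ t ∈ closure z.region := by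
  rw [← closure_Ioo h.pos.ne] at ht
  exact map_mem_closure h.sol.continuous ht h.inside

theorem exists_side_sub_mul_nonneg (h : S.IsArc ε z p q γ T) {s t : ℝ} (hs : s ∈ Icc 0 T)
    (ht : t ∈ Icc 0 T) (hline : (γ s).1 = 1 ∨ (γ s).1 = -1) :
    ∃ σ, Side z (γ s).1 σ ∧ 0 ≤ (t - s) * (σ * (S.field ε z (γ s)).1) := by
  obtain ⟨σ, hσ⟩ := exists_side hline (h.mem_closure hs)
  refine ⟨σ, hσ, sub_mul_deriv_nonneg_of_forall_uIcc_le
    ((hasDerivAt_fst_comp (h.sol s)).const_mul σ) fun r hr => ?_⟩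
  linarith [hσ.nonneg_of_mem_closure (h.mem_closure (uIcc_subset_Icc hs ht hr))]

theorem exists_side_start (h : S.IsArc ε z p q γ T) (hp : p.1 = 1 ∨ p.1 = -1) :
    ∃ σ, Side z p.1 σ ∧ 0 ≤ σ * (S.field ε z p).1 := by
  rw [← h.init] at hp ⊢
  obtain ⟨σ, hσ, hnn⟩ := h.exists_side_sub_mul_nonneg (left_mem_Icc.2 h.pos.le)
    (right_mem_Icc.2 h.pos.le) hp
  exact ⟨σ, hσ, nonneg_of_mul_nonneg_right hnn (by linarith [h.pos])⟩

theorem exists_side_end (h : S.IsArc ε z p q γ T) (hq : q.1 = 1 ∨ q.1 = -1) :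
    ∃ σ, Side z q.1 σ ∧ σ * (S.field ε z q).1 ≤ 0 := by
  rw [← h.term] at hq ⊢
  obtain ⟨σ, hσ, hnn⟩ := h.exists_side_sub_mul_nonneg (right_mem_Icc.2 h.pos.le)
    (left_mem_Icc.2 h.pos.le) hq
  exact ⟨σ, hσ, by nlinarith [h.pos]⟩

theorem eq_flow (h : S.IsArc ε z p q γ T) : γ = fun t => S.flow ε z t p := by
  rw [← h.init]
  exact h.sol.eq_flow

theorem time_le {q' : ℝ × ℝ} {γ' : ℝ → ℝ × ℝ} {T' : ℝ} (h : S.IsArc ε z p q γ T)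
    (h' : S.IsArc ε z p q' γ' T') (hq' : q'.1 = 1 ∨ q'.1 = -1) : T ≤ T' := by
  by_contra! hlt
  refine notMem_region_of_line hq' z ?_
  rw [← h'.term, h'.eq_flow, ← h.eq_flow]
  exact h.inside T' ⟨h'.pos, hlt⟩

theorem unique {q' : ℝ × ℝ} {γ' : ℝ → ℝ × ℝ} {T' : ℝ} (h : S.IsArc ε z p q γ T)
    (h' : S.IsArc ε z p q' γ' T') (hq : q.1 = 1 ∨ q.1 = -1) (hq' : q'.1 = 1 ∨ q'.1 = -1) :
    γ = γ' ∧ T = T' ∧ q = q' := by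
  have hγ : γ = γ' := by rw [h.eq_flow, h'.eq_flow]
  have hT : T = T' := (h.time_le h' hq').antisymm (h'.time_le h hq)
  exact ⟨hγ, hT, by rw [← h.term, ← h'.term, hγ, hT]⟩

end IsArc

end Sys

/-! ### The transition map along an arc -/

theorem exists_implicit_time {E : Type*} [NormedAddCommGroup E] [NormedSpace ℝ E]
    [CompleteSpace E] {n : WithTop ℕ∞} (hn : n ≠ 0) {f : E × ℝ → ℝ} {a : E} {T f' : ℝ}
    (hf : ContDiffAt ℝ n f (a, T)) (hd : HasDerivAt (fun t => f (a, t)) f' T) (hf' : f' ≠ 0) :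
    ∃ τ : E → ℝ, τ a = T ∧ ContDiffAt ℝ n τ a ∧ ∀ᶠ q in 𝓝 a, f (q, τ q) = f (a, T) := by
  have hinv : (fderiv ℝ f (a, T) ∘L .inr ℝ E ℝ).IsInvertible := by
    have hd' : HasDerivAt (fun t => f (a, t)) (fderiv ℝ f (a, T) (0, 1)) T :=
      (hf.differentiableAt hn).hasFDerivAt.comp_hasDerivAt T
        ((hasDerivAt_const T a).prodMk (hasDerivAt_id T))
    refine ⟨ContinuousLinearEquiv.unitsEquivAut ℝ (Units.mk0 f' hf'), ?_⟩
    ext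
    simp [hd.unique hd']
  exact ⟨hf.implicitFunction hn hinv, hf.implicitFunction_apply_self hn hinv,
    hf.contDiffAt_implicitFunction hn hinv, hf.eventually_apply_implicitFunction hn hinv⟩

theorem eventually_lt_of_deriv_mul_pos {X : Type*} [TopologicalSpace X] {u u' : X → ℝ → ℝ}
    (hu : ∀ q t, HasDerivAt (u q) (u' q t) t) {q₀ : X} {t₀ : ℝ}
    (hc : ContinuousAt (fun w : X × ℝ => u' w.1 w.2) (q₀, t₀)) :
    ∀ᶠ w : X × ℝ in 𝓝 (q₀, t₀), 0 < u' q₀ t₀ * (w.2 - t₀) → u w.1 t₀ < u w.1 w.2 := by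
  rcases eq_or_ne (u' q₀ t₀) 0 with hzero | hne
  · simp [hzero]
  have hpos : ∀ᶠ w : X × ℝ in 𝓝 q₀ ×ˢ 𝓝 t₀, 0 < u' q₀ t₀ * u' w.1 w.2 := by
    rw [← nhds_prod_eq]
    exact (continuousAt_const.mul hc).eventually (eventually_gt_nhds (mul_self_pos.2 hne))
  obtain ⟨P, hP, Q, hQ, hPQ⟩ := eventually_prod_iff.1 hpos
  obtain ⟨r, hr, hball⟩ := Metric.eventually_nhds_iff_ball.1 hQ
  rw [nhds_prod_eq]
  filter_upwards [hP.prod_mk (Metric.ball_mem_nhds t₀ hr)] with w ⟨hw, hwr⟩ hsign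
  have hmono : StrictMonoOn (fun t => u' q₀ t₀ * u w.1 t) (Metric.ball t₀ r) :=
    strictMonoOn_of_deriv_pos (convex_ball t₀ r)
      (fun t _ => ((hu w.1 t).const_mul _).continuousAt.continuousWithinAt) fun t ht => by
        rw [((hu w.1 t).const_mul _).deriv]
        exact hPQ hw (hball t (interior_subset ht))
  have ht₀ := Metric.mem_ball_self (x := t₀) hr
  rcases mul_pos_iff.1 hsign with ⟨hu', ht⟩ | ⟨hu', ht⟩
  · exact lt_of_mul_lt_mul_left (hmono ht₀ hwr (by linarith)) hu'.le
  · exact lt_of_mul_lt_mul_of_nonpos_left (hmono hwr ht₀ (by linarith)) hu'.le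

theorem Side.eventually_flow_mem_region {z : Zone} {p : ℝ × ℝ} {σ : ℝ} (hσ : Side z p.1 σ)
    (S : Sys) (ε : ℝ) :
    ∀ᶠ w : (ℝ × (ℝ × ℝ)) × ℝ in 𝓝 ((ε, p), 0), w.1.2.1 = p.1 →
      0 < σ * (S.field ε z p).1 * w.2 → S.flow w.1.1 z w.2 w.1.2 ∈ z.region := by
  have hflow : Continuous fun w : (ℝ × (ℝ × ℝ)) × ℝ => S.flow w.1.1 z w.2 w.1.2 :=
    (S.continuous_flow z).comp (f := fun w : (ℝ × (ℝ × ℝ)) × ℝ => (w.1.1, w.2, w.1.2))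
      (by fun_prop)
  have hfield : Continuous fun w : (ℝ × (ℝ × ℝ)) × ℝ =>
      σ * (S.field w.1.1 z (S.flow w.1.1 z w.2 w.1.2)).1 :=
    continuous_const.mul ((S.continuous_field z).comp (continuous_fst.fst.prodMk hflow)).fst
  have hmono := eventually_lt_of_deriv_mul_pos
    (u := fun (q : ℝ × (ℝ × ℝ)) t => σ * (S.flow q.1 z t q.2).1)
    (fun q t => (hasDerivAt_fst_comp (S.isSolution_flow q.1 z q.2 t)).const_mul σ)
    (hfield.continuousAt (x := ((ε, p), 0)))
  have hnear : Tendsto (fun w : (ℝ × (ℝ × ℝ)) × ℝ => (S.flow w.1.1 z w.2 w.1.2).1)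
      (𝓝 ((ε, p), 0)) (𝓝 p.1) := by
    simpa only [S.flow_zero] using hflow.fst.tendsto ((ε, p), (0 : ℝ))
  filter_upwards [hmono, hnear.eventually hσ.eventually_mem_region] with w hmono hmem hline hsign
  simp only [S.flow_zero, sub_zero] at hmono
  exact hmem (by linarith [hline ▸ hmono hsign]) _

namespace Sys

variable {S : Sys} {ε : ℝ} {z : Zone} {x₀ y₀ x₁ y₁ : ℝ} {γ : ℝ → ℝ × ℝ} {T : ℝ}
  {τ : ℝ × ℝ → ℝ}

theorem continuousAt_flow_mul_time (S : Sys) (z : Zone) (x₀ : ℝ) {q₀ : ℝ × ℝ}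
    (hτ : ContinuousAt τ q₀) (s : ℝ) :
    ContinuousAt (fun w : (ℝ × ℝ) × ℝ => S.flow w.1.1 z (w.2 * τ w.1) (x₀, w.1.2)) (q₀, s) := by
  have hτ' : ContinuousAt (fun w : (ℝ × ℝ) × ℝ => τ w.1) (q₀, s) :=
    ContinuousAt.comp (f := Prod.fst) hτ continuousAt_fst
  exact ContinuousAt.comp
    (f := fun w : (ℝ × ℝ) × ℝ => (w.1.1, w.2 * τ w.1, (x₀, w.1.2)))
    (S.continuous_flow z).continuousAt (continuousAt_fst.fst.prodMk
      ((continuousAt_snd.mul hτ').prodMk (continuousAt_const.prodMk continuousAt_fst.snd)))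

theorem eventually_flow_image_subset (S : Sys) (z : Zone) (hτ : ContinuousAt τ (ε, y₀))
    (hpos : 0 < τ (ε, y₀)) {U : Set (ℝ × ℝ)} (hU : IsOpen U)
    (hsub : (fun t => S.flow ε z t (x₀, y₀)) '' Icc 0 (τ (ε, y₀)) ⊆ U) :
    ∀ᶠ q : ℝ × ℝ in 𝓝 (ε, y₀), (fun t => S.flow q.1 z t (x₀, q.2)) '' Icc 0 (τ q) ⊆ U := by
  have hmem : ∀ᶠ q in 𝓝 (ε, y₀), ∀ s ∈ Icc (0 : ℝ) 1,
      S.flow q.1 z (s * τ q) (x₀, q.2) ∈ U :=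
    isCompact_Icc.eventually_forall_of_forall_eventually fun s hs =>
      (S.continuousAt_flow_mul_time z x₀ hτ s).eventually (hU.mem_nhds
        (hsub ⟨_, ⟨mul_nonneg hs.1 hpos.le, mul_le_of_le_one_left hpos.le hs.2⟩, rfl⟩))
  filter_upwards [hmem, hτ.eventually (eventually_gt_nhds hpos)] with q hq hpos
  rintro _ ⟨t, ht, rfl⟩
  have := hq (t / τ q) ⟨div_nonneg ht.1 hpos.le, (div_le_one hpos).2 ht.2⟩
  rwa [div_mul_cancel₀ _ hpos.ne'] at this

namespace IsArc

theorem eventually_flow_mem_region_start (h : S.IsArc ε z (x₀, y₀) (x₁, y₁) γ T)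
    (hx₀ : x₀ = 1 ∨ x₀ = -1) (h₀ : (S.field ε z (x₀, y₀)).1 ≠ 0) (hτ : ContinuousAt τ (ε, y₀))
    (hτT : τ (ε, y₀) = T) :
    ∀ᶠ w : (ℝ × ℝ) × ℝ in 𝓝 ((ε, y₀), 0), w.2 ∈ Ioo 0 1 →
      S.flow w.1.1 z (w.2 * τ w.1) (x₀, w.1.2) ∈ z.region := by
  obtain ⟨σ, hσ, hin⟩ := h.exists_side_start hx₀
  have hin : 0 < σ * (S.field ε z (x₀, y₀)).1 :=
    hin.lt_of_ne' (mul_ne_zero hσ.sign_ne_zero h₀)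
  have hτ' : ContinuousAt (fun w : (ℝ × ℝ) × ℝ => τ w.1) ((ε, y₀), 0) :=
    ContinuousAt.comp (f := Prod.fst) hτ continuousAt_fst
  have hlim : Tendsto (fun w : (ℝ × ℝ) × ℝ => ((w.1.1, (x₀, w.1.2)), w.2 * τ w.1))
      (𝓝 ((ε, y₀), 0)) (𝓝 ((ε, (x₀, y₀)), 0)) := by
    simpa [ContinuousAt] using show ContinuousAt (fun w : (ℝ × ℝ) × ℝ =>
      ((w.1.1, (x₀, w.1.2)), w.2 * τ w.1)) ((ε, y₀), 0) by fun_prop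
  filter_upwards [hlim.eventually (hσ.eventually_flow_mem_region S ε),
    hτ'.eventually (eventually_gt_nhds (hτT ▸ h.pos))] with w hw hpos hs
  exact hw rfl (mul_pos hin (mul_pos hs.1 hpos))

theorem eventually_flow_mem_region_end (h : S.IsArc ε z (x₀, y₀) (x₁, y₁) γ T)
    (hx₁ : x₁ = 1 ∨ x₁ = -1) (h₁ : (S.field ε z (x₁, y₁)).1 ≠ 0) (hτ : ContinuousAt τ (ε, y₀))
    (hτT : τ (ε, y₀) = T)
    (hhit : ∀ᶠ q in 𝓝 (ε, y₀), (S.flow q.1 z (τ q) (x₀, q.2)).1 = x₁) :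
    ∀ᶠ w : (ℝ × ℝ) × ℝ in 𝓝 ((ε, y₀), 1), w.2 ∈ Ioo 0 1 →
      S.flow w.1.1 z (w.2 * τ w.1) (x₀, w.1.2) ∈ z.region := by
  obtain ⟨σ, hσ, hout⟩ := h.exists_side_end hx₁
  have hout : σ * (S.field ε z (x₁, y₁)).1 < 0 :=
    hout.lt_of_ne (mul_ne_zero hσ.sign_ne_zero h₁)
  have hτ' : ContinuousAt (fun w : (ℝ × ℝ) × ℝ => τ w.1) ((ε, y₀), 1) :=
    ContinuousAt.comp (f := Prod.fst) hτ continuousAt_fst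
  let e : ℝ × ℝ → ℝ × ℝ := fun q => S.flow q.1 z (τ q) (x₀, q.2)
  have he : ContinuousAt (fun w : (ℝ × ℝ) × ℝ => e w.1) ((ε, y₀), 1) :=
    ContinuousAt.comp (f := fun w : (ℝ × ℝ) × ℝ => (w.1.1, τ w.1, (x₀, w.1.2)))
      (S.continuous_flow z).continuousAt (by fun_prop)
  have he₀ : e (ε, y₀) = (x₁, y₁) := by rw [← h.term, h.eq_flow, ← hτT]
  have hlim : Tendsto (fun w : (ℝ × ℝ) × ℝ => ((w.1.1, e w.1), (w.2 - 1) * τ w.1))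
      (𝓝 ((ε, y₀), 1)) (𝓝 ((ε, (x₁, y₁)), 0)) := by
    simpa only [ContinuousAt, he₀, sub_self, zero_mul] using
      (continuousAt_fst.fst.prodMk he).prodMk ((continuousAt_snd.sub_const 1).mul hτ')
  filter_upwards [hlim.eventually (hσ.eventually_flow_mem_region S ε),
    hτ'.eventually (eventually_gt_nhds (hτT ▸ h.pos)), continuousAt_fst.eventually hhit]
    with w hw hpos hhit hs
  have hmem := hw hhit (mul_pos_of_neg_of_neg hout
    (mul_neg_of_neg_of_pos (by linarith [hs.2]) hpos))
  rwa [(S.isSolution_flow w.1.1 z (x₀, w.1.2)).flow_apply,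
    show (w.2 - 1) * τ w.1 + τ w.1 = w.2 * τ w.1 by ring] at hmem

theorem eventually_isArc (h : S.IsArc ε z (x₀, y₀) (x₁, y₁) γ T) (hx₀ : x₀ = 1 ∨ x₀ = -1)
    (hx₁ : x₁ = 1 ∨ x₁ = -1) (h₀ : (S.field ε z (x₀, y₀)).1 ≠ 0)
    (h₁ : (S.field ε z (x₁, y₁)).1 ≠ 0) (hτ : ContinuousAt τ (ε, y₀)) (hτT : τ (ε, y₀) = T)
    (hhit : ∀ᶠ q in 𝓝 (ε, y₀), (S.flow q.1 z (τ q) (x₀, q.2)).1 = x₁) :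
    ∀ᶠ q : ℝ × ℝ in 𝓝 (ε, y₀), S.IsArc q.1 z (x₀, q.2)
      (x₁, (S.flow q.1 z (τ q) (x₀, q.2)).2) (fun t => S.flow q.1 z t (x₀, q.2)) (τ q) := by
  have hinside : ∀ᶠ q in 𝓝 (ε, y₀), ∀ s ∈ Icc (0 : ℝ) 1, s ∈ Ioo (0 : ℝ) 1 →
      S.flow q.1 z (s * τ q) (x₀, q.2) ∈ z.region := by
    refine isCompact_Icc.eventually_forall_of_forall_eventually fun s hs => ?_
    rcases hs.1.eq_or_lt with rfl | hs₀
    · exact h.eventually_flow_mem_region_start hx₀ h₀ hτ hτT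
    rcases hs.2.eq_or_lt with rfl | hs₁
    · exact h.eventually_flow_mem_region_end hx₁ h₁ hτ hτT hhit
    have hmem : S.flow ε z (s * τ (ε, y₀)) (x₀, y₀) ∈ z.region := by
      rw [hτT, ← congrFun h.eq_flow]
      exact h.inside _ ⟨mul_pos hs₀ h.pos, mul_lt_of_lt_one_left h.pos hs₁⟩
    filter_upwards [(S.continuousAt_flow_mul_time z x₀ hτ s).eventually
      ((isOpen_region z).mem_nhds hmem)] with w hw _ using hw
  filter_upwards [hinside, hτ.eventually (eventually_gt_nhds (hτT ▸ h.pos)), hhit]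
    with q hq hpos hhit
  refine ⟨hpos, S.isSolution_flow _ _ _, S.flow_zero _ _ _, Prod.ext hhit rfl, fun t ht => ?_⟩
  have hs : t / τ q ∈ Ioo (0 : ℝ) 1 := ⟨div_pos ht.1 hpos, (div_lt_one hpos).2 ht.2⟩
  simpa only [div_mul_cancel₀ _ hpos.ne'] using hq _ (Ioo_subset_Icc_self hs) hs

theorem exists_transitionTime (h : S.IsArc ε z (x₀, y₀) (x₁, y₁) γ T)
    (hx₀ : x₀ = 1 ∨ x₀ = -1) (hx₁ : x₁ = 1 ∨ x₁ = -1) (h₀ : (S.field ε z (x₀, y₀)).1 ≠ 0)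
    (h₁ : (S.field ε z (x₁, y₁)).1 ≠ 0) :
    ∃ τ : ℝ × ℝ → ℝ, τ (ε, y₀) = T ∧ ContDiffAt ℝ 2 τ (ε, y₀) ∧
      ∀ᶠ q : ℝ × ℝ in 𝓝 (ε, y₀), S.IsArc q.1 z (x₀, q.2)
        (x₁, (S.flow q.1 z (τ q) (x₀, q.2)).2) (fun t => S.flow q.1 z t (x₀, q.2)) (τ q) := by
  have hterm : S.flow ε z T (x₀, y₀) = (x₁, y₁) := by rw [← h.term, h.eq_flow]
  let f : (ℝ × ℝ) × ℝ → ℝ := fun w => (S.flow w.1.1 z w.2 (x₀, w.1.2)).1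
  have hf : ContDiff ℝ 2 f :=
    ((S.contDiff_flow z).comp
      (show ContDiff ℝ 2 fun w : (ℝ × ℝ) × ℝ => (w.1.1, w.2, (x₀, w.1.2)) by fun_prop)).fst
  have hd : HasDerivAt (fun t => f ((ε, y₀), t)) (S.field ε z (x₁, y₁)).1 T := by
    simpa only [hterm] using hasDerivAt_fst_comp (S.isSolution_flow ε z (x₀, y₀) T)
  obtain ⟨τ, hτT, hτ, hhit⟩ := exists_implicit_time two_ne_zero hf.contDiffAt hd h₁
  simp only [f, hterm] at hhit
  exact ⟨τ, hτT, hτ, h.eventually_isArc hx₀ hx₁ h₀ h₁ hτ.continuousAt hτT hhit⟩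

end IsArc

end Sys

/-! ### Energy balance along an arc -/

theorem Ham.hasDerivAt_val_comp (H : Ham) {γ : ℝ → ℝ × ℝ} {γ' : ℝ × ℝ} {t : ℝ}
    (h : HasDerivAt γ γ' t) :
    HasDerivAt (fun s => H.val (γ s)) (H.dx (γ t) * γ'.1 + H.dy (γ t) * γ'.2) t := by
  have hx := hasDerivAt_fst_comp h
  have hy := hasDerivAt_snd_comp h
  have hval := (((((hy.pow 2).const_mul (H.b / 2)).sub ((hx.pow 2).const_mul (H.c / 2))).add
    ((hx.const_mul H.a).mul hy)).add (hy.const_mul H.α)).sub (hx.const_mul H.β)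
  refine hval.congr_deriv ?_
  simp only [dx, dy]
  push_cast
  ring

theorem hasDerivAt_sub_smul_of_continuousAt {𝕜 E : Type*} [NontriviallyNormedField 𝕜]
    [NormedAddCommGroup E] [NormedSpace 𝕜 E] {f : 𝕜 → E} {a : 𝕜} (hf : ContinuousAt f a) :
    HasDerivAt (fun t => (t - a) • f t) (f a) a := by
  rw [hasDerivAt_iff_tendsto_slope]
  refine (hf.tendsto.mono_left nhdsWithin_le_nhds).congr' ?_
  filter_upwards [self_mem_nhdsWithin] with t ht
  simp [slope_def_module, inv_smul_smul₀ (sub_ne_zero.2 ht)]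

namespace Sys

theorem field_zero_fst (S : Sys) (z : Zone) (p : ℝ × ℝ) : (S.field 0 z p).1 = (S.H z).dy p := by
  simp [field]

/-- The rate of change of the energy `H^z` along the field of the zone `z`, divided by `ε`; it is
the integrand of the line integrals of the Melnikov functions. -/
def power (S : Sys) (z : Zone) (p : ℝ × ℝ) : ℝ :=
  (S.f z).val p * (S.H z).dx p + (S.g z).val p * (S.H z).dy p

theorem continuous_power (S : Sys) (z : Zone) : Continuous (S.power z) := by
  unfold power Ham.dx Ham.dy Aff.val
  fun_prop

section Energy

variable {S : Sys} {ε : ℝ} {z : Zone} {γ : ℝ → ℝ × ℝ}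

theorem IsSolution.hasDerivAt_energy (h : S.IsSolution ε z γ) (t : ℝ) :
    HasDerivAt (fun s => (S.H z).val (γ s)) (ε * S.power z (γ t)) t := by
  refine ((S.H z).hasDerivAt_val_comp (h t)).congr_deriv ?_
  simp only [field, power]
  ring

theorem IsSolution.energy_sub (h : S.IsSolution ε z γ) (T : ℝ) :
    (S.H z).val (γ T) - (S.H z).val (γ 0) = ε * ∫ t in (0 : ℝ)..T, S.power z (γ t) := by
  rw [← intervalIntegral.integral_const_mul]
  refine (intervalIntegral.integral_eq_sub_of_hasDerivAt (fun t _ => h.hasDerivAt_energy t)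
    (Continuous.intervalIntegrable ?_ _ _)).symm
  exact continuous_const.mul ((S.continuous_power z).comp h.continuous)

theorem IsSolution.lineInt_eq (h : S.IsSolution 0 z γ) (T : ℝ) :
    S.lineInt z γ T = ∫ t in (0 : ℝ)..T, S.power z (γ t) := by
  refine intervalIntegral.integral_congr fun t _ => ?_
  simp only [(hasDerivAt_fst_comp (h t)).deriv, (hasDerivAt_snd_comp (h t)).deriv, field, power]
  ring

end Energy

/-- The work `∫₀ᵀ power` of the perturbation along the orbit of `p` in the zone `z`. -/
noncomputable def work (S : Sys) (z : Zone) (ε T : ℝ) (p : ℝ × ℝ) : ℝ :=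
  ∫ t in (0 : ℝ)..T, S.power z (S.flow ε z t p)

theorem continuous_work (S : Sys) (z : Zone) :
    Continuous fun q : ℝ × ℝ × (ℝ × ℝ) => S.work z q.1 q.2.1 q.2.2 := by
  have hpow : Continuous fun w : (ℝ × (ℝ × ℝ)) × ℝ => S.power z (S.flow w.1.1 z w.2 w.1.2) :=
    (S.continuous_power z).comp ((S.continuous_flow z).comp
      (f := fun w : (ℝ × (ℝ × ℝ)) × ℝ => (w.1.1, w.2, w.1.2)) (by fun_prop))
  exact (intervalIntegral.continuous_parametric_primitive_of_continuous
    (f := fun (q : ℝ × (ℝ × ℝ)) t => S.power z (S.flow q.1 z t q.2)) hpow).comp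
    (f := fun q : ℝ × ℝ × (ℝ × ℝ) => ((q.1, q.2.2), q.2.1)) (by fun_prop)

theorem energy_flow (S : Sys) (z : Zone) (ε T : ℝ) (p : ℝ × ℝ) :
    (S.H z).val (S.flow ε z T p) = (S.H z).val p + ε * S.work z ε T p := by
  have h := (S.isSolution_flow ε z p).energy_sub T
  rw [S.flow_zero] at h
  unfold work
  linarith

section Variation

variable {S : Sys} {z : Zone} {x₀ y₀ x₁ y₁ T : ℝ} {γ : ℝ → ℝ × ℝ}

theorem IsSolution.work_eq_lineInt (h : S.IsSolution 0 z γ) (T : ℝ) :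
    S.work z 0 T (γ 0) = S.lineInt z γ T := by
  rw [h.lineInt_eq, work]
  exact intervalIntegral.integral_congr fun t _ => congrArg (S.power z) (congrFun h.eq_flow t).symm

theorem hasDerivAt_energy_flow {Y τ : ℝ → ℝ} {Y' : ℝ} (hY : HasDerivAt Y Y' 0)
    (hτ : ContinuousAt τ 0) :
    HasDerivAt (fun ε => (S.H z).val (S.flow ε z (τ ε) (x₀, Y ε)))
      ((S.H z).dy (x₀, Y 0) * Y' + S.work z 0 (τ 0) (x₀, Y 0)) 0 := by
  have hW : ContinuousAt (fun ε => S.work z ε (τ ε) (x₀, Y ε)) 0 :=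
    (S.continuous_work z).continuousAt.comp (f := fun ε => (ε, τ ε, (x₀, Y ε)))
      (continuousAt_id.prodMk (hτ.prodMk (continuousAt_const.prodMk hY.continuousAt)))
  have hstart := (S.H z).hasDerivAt_val_comp ((hasDerivAt_const (0 : ℝ) x₀).prodMk hY)
  refine ((hstart.add (hasDerivAt_sub_smul_of_continuousAt hW)).congr_of_eventuallyEq
    (.of_forall fun ε => ?_)).congr_deriv (by simp)
  simp [energy_flow]

/-- The two derivatives of the energy at the end point, computed from its motion along the line
`x = x₁` and from the work along the arc, are equal; this gives the variation of the ordinate. -/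
theorem IsArc.hasDerivAt_end (h : S.IsArc 0 z (x₀, y₀) (x₁, y₁) γ T)
    (h₁ : (S.H z).dy (x₁, y₁) ≠ 0) {τ Y : ℝ → ℝ} {Y' : ℝ} (hτ : DifferentiableAt ℝ τ 0)
    (hτ0 : τ 0 = T) (hY : HasDerivAt Y Y' 0) (hY0 : Y 0 = y₀)
    (hline : ∀ᶠ ε in 𝓝 0, (S.flow ε z (τ ε) (x₀, Y ε)).1 = x₁) :
    HasDerivAt (fun ε => (S.flow ε z (τ ε) (x₀, Y ε)).2)
      ((S.lineInt z γ T + (S.H z).dy (x₀, y₀) * Y') / (S.H z).dy (x₁, y₁)) 0 := by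
  have hdiff : DifferentiableAt ℝ (fun ε => S.flow ε z (τ ε) (x₀, Y ε)) 0 :=
    DifferentiableAt.comp (f := fun ε => (ε, τ ε, (x₀, Y ε))) 0
      ((S.contDiff_flow z (n := 1)).differentiable one_ne_zero _)
      (differentiableAt_id.prodMk (hτ.prodMk
        ((differentiableAt_const x₀).prodMk hY.differentiableAt)))
  have hy := hdiff.snd.hasDerivAt
  have hend : S.flow 0 z T (x₀, y₀) = (x₁, y₁) := by
    rw [← h.init, h.sol.flow_apply, add_zero, h.term]
  have hleft := (S.H z).hasDerivAt_val_comp ((hasDerivAt_const (0 : ℝ) x₁).prodMk hy)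
  have hright := hasDerivAt_energy_flow (S := S) (z := z) (x₀ := x₀) hY hτ.continuousAt
  have hsame := hleft.unique (hright.congr_of_eventuallyEq
    (hline.mono fun ε hε => by simp only [← hε, Prod.mk.eta]))
  simp only [hY0, hτ0, hend, mul_zero, zero_add] at hsame
  refine hy.congr_deriv ?_
  rw [eq_div_iff h₁, mul_comm, hsame, ← h.init, h.sol.work_eq_lineInt, add_comm]

end Variation

end Sys

/-! ### Simple zeros of first order displacements -/

theorem isBigO_sub_sq_of_contDiffAt {E : Type*} [NormedAddCommGroup E] [NormedSpace ℝ E]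
    {f : ℝ → E} {a : ℝ} {f' : E} (hf : ContDiffAt ℝ 2 f a) (hf' : HasDerivAt f f' a) :
    (fun x => f x - f a - (x - a) • f') =O[𝓝[≥] a] fun x => (x - a) ^ 2 := by
  obtain ⟨u, hu, hfu⟩ := hf.contDiffOn (m := 2) le_rfl (by simp)
  obtain ⟨b, hab, hbu⟩ := mem_nhdsGE_iff_exists_Icc_subset.1 (mem_nhdsWithin_of_mem_nhds hu)
  obtain ⟨C, hC⟩ := exists_taylor_mean_remainder_bound (n := 1) hab.le
    ((hfu.mono hbu).of_le (by norm_num))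
  refine .of_bound C ?_
  filter_upwards [Icc_mem_nhdsGE hab] with x hx
  have h := hC x hx
  rw [taylorWithinEval_succ, taylor_within_zero_eval, iteratedDerivWithin_one,
    hf'.hasDerivWithinAt.derivWithin (uniqueDiffOn_Icc hab a (left_mem_Icc.2 hab.le))] at h
  simpa [sub_sub] using h

theorem eventually_deriv_mul_mul_sub_pos {f : ℝ → ℝ} {a : ℝ} (hf : deriv f a ≠ 0)
    (ha : f a = 0) : ∀ᶠ x in 𝓝[≠] a, 0 < deriv f a * f x * (x - a) := by
  have hslope : Tendsto (fun x => deriv f a * slope f a x) (𝓝[≠] a) (𝓝 (deriv f a * deriv f a)) :=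
    (differentiableAt_of_deriv_ne_zero hf).hasDerivAt.tendsto_slope.const_mul _
  filter_upwards [hslope.eventually (eventually_gt_nhds (mul_self_pos.2 hf)),
    self_mem_nhdsWithin] with x hx hxa
  have hxa' : x - a ≠ 0 := sub_ne_zero.2 hxa
  calc 0 < deriv f a * slope f a x * ((x - a) * (x - a)) := mul_pos hx (mul_self_pos.2 hxa')
    _ = deriv f a * f x * (x - a) := by
      rw [slope_def_field, ha, sub_zero]
      field_simp

theorem eventually_hasDerivAt_left {F : ℝ × ℝ → ℝ} {q₀ : ℝ × ℝ} (hF : ContDiffAt ℝ 1 F q₀) :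
    ∀ᶠ q in 𝓝 q₀, HasDerivAt (fun x => F (x, q.2)) (fderiv ℝ F q (1, 0)) q.1 := by
  filter_upwards [hF.eventually (by simp)] with q hq
  exact (hq.differentiableAt one_ne_zero).hasFDerivAt.comp_hasDerivAt q.1
    ((hasDerivAt_id q.1).prodMk (hasDerivAt_const q.1 q.2))

theorem eventually_hasDerivAt_right {F : ℝ × ℝ → ℝ} {q₀ : ℝ × ℝ} (hF : ContDiffAt ℝ 1 F q₀) :
    ∀ᶠ q in 𝓝 q₀, HasDerivAt (fun y => F (q.1, y)) (fderiv ℝ F q (0, 1)) q.2 := by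
  filter_upwards [hF.eventually (by simp)] with q hq
  exact (hq.differentiableAt one_ne_zero).hasFDerivAt.comp_hasDerivAt q.2
    ((hasDerivAt_const q.2 q.1).prodMk (hasDerivAt_id q.2))

/-- Rolle's theorem, applied in each variable. -/
theorem injOn_of_mixed_deriv_ne_zero {F G G' : ℝ × ℝ → ℝ} {a ε : ℝ} {s : Set ℝ}
    (hs : s.OrdConnected) (hε : a < ε)
    (hF : ∀ q ∈ Icc a ε ×ˢ s, HasDerivAt (fun x => F (x, q.2)) (G q) q.1)
    (hG : ∀ q ∈ Icc a ε ×ˢ s, HasDerivAt (fun y => G (q.1, y)) (G' q) q.2)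
    (hG' : ∀ q ∈ Icc a ε ×ˢ s, G' q ≠ 0) (ha : ∀ y ∈ s, F (a, y) = 0) :
    InjOn (fun y => F (ε, y)) s := by
  intro y hy y' hy' heq
  by_contra! hne
  wlog hlt : y < y' generalizing y y'
  · exact this hy' hy heq.symm hne.symm (lt_of_le_of_ne (not_lt.1 hlt) hne.symm)
  have hd : ∀ e ∈ Icc a ε,
      HasDerivAt (fun x => F (x, y) - F (x, y')) (G (e, y) - G (e, y')) e :=
    fun e he => (hF (e, y) ⟨he, hy⟩).sub (hF (e, y') ⟨he, hy'⟩)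
  obtain ⟨e, he, hGe⟩ := exists_hasDerivAt_eq_zero hε
    (fun e he => (hd e he).continuousAt.continuousWithinAt)
    (by simp only [ha y hy, ha y' hy', sub_self, sub_eq_zero.2 heq])
    (fun e he => hd e (Ioo_subset_Icc_self he))
  have hmem : ∀ t ∈ Icc y y', (e, t) ∈ Icc a ε ×ˢ s :=
    fun t ht => ⟨Ioo_subset_Icc_self he, hs.out hy hy' ht⟩
  obtain ⟨t, ht, hGt⟩ := exists_hasDerivAt_eq_zero hlt
    (fun t ht => (hG _ (hmem t ht)).continuousAt.continuousWithinAt) (sub_eq_zero.1 hGe)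
    (fun t ht => hG _ (hmem t (Ioo_subset_Icc_self ht)))
  exact hG' _ (hmem t (Ioo_subset_Icc_self ht)) hGt

section SimpleZero

variable {F : ℝ × ℝ → ℝ} {y₀ : ℝ}

theorem deriv_left_eventuallyEq (hF : ContDiffAt ℝ 1 F (0, y₀)) :
    (fun y => deriv (fun ε => F (ε, y)) 0) =ᶠ[𝓝 y₀] fun y => fderiv ℝ F (0, y) (1, 0) :=
  (Tendsto.eventually (f := fun y : ℝ => ((0 : ℝ), y))
    (continuous_const.prodMk continuous_id).continuousAt (eventually_hasDerivAt_left hF)).mono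
    fun _ h => h.deriv

theorem contDiffAt_fderiv_apply {E E' : Type*} [NormedAddCommGroup E] [NormedSpace ℝ E]
    [NormedAddCommGroup E'] [NormedSpace ℝ E'] {f : E → E'} {p : E} (hf : ContDiffAt ℝ 2 f p)
    (v : E) : ContDiffAt ℝ 1 (fun q => fderiv ℝ f q v) p :=
  (hf.fderiv_right (by norm_num)).clm_apply contDiffAt_const

theorem differentiableAt_deriv_left (hF : ContDiffAt ℝ 2 F (0, y₀)) :
    DifferentiableAt ℝ (fun y => deriv (fun ε => F (ε, y)) 0) y₀ := by
  refine DifferentiableAt.congr_of_eventuallyEq ?_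
    (deriv_left_eventuallyEq (hF.of_le one_le_two))
  exact (eventually_hasDerivAt_right
    (contDiffAt_fderiv_apply hF (1, 0))).self_of_nhds.differentiableAt

theorem exists_eventually_injOn_of_mixed_deriv_ne_zero (hF : ContDiffAt ℝ 2 F (0, y₀))
    (hF0 : ∀ᶠ y in 𝓝 y₀, F (0, y) = 0)
    (hm : deriv (fun y => deriv (fun ε => F (ε, y)) 0) y₀ ≠ 0) :
    ∃ V ∈ 𝓝 y₀, ∀ᶠ ε in 𝓝[>] 0, InjOn (fun y => F (ε, y)) V := by
  set G : ℝ × ℝ → ℝ := fun q => fderiv ℝ F q (1, 0)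
  have hG : ContDiffAt ℝ 1 G (0, y₀) := contDiffAt_fderiv_apply hF (1, 0)
  have hGy := eventually_hasDerivAt_right hG
  rw [(deriv_left_eventuallyEq (hF.of_le one_le_two)).deriv_eq, hGy.self_of_nhds.deriv] at hm
  have hne : ∀ᶠ q in 𝓝 (0, y₀), fderiv ℝ G q (0, 1) ≠ 0 :=
    ((hG.fderiv_right (m := 0) (by norm_num)).continuousAt.clm_apply
      continuousAt_const).eventually_ne hm
  obtain ⟨r, hr, hball⟩ := Metric.eventually_nhds_iff_ball.1
    ((eventually_hasDerivAt_left (hF.of_le one_le_two)).and (hGy.and hne))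
  obtain ⟨ρ, hρ, hball₀⟩ := Metric.eventually_nhds_iff_ball.1 hF0
  rw [← ball_prod_same] at hball
  refine ⟨Metric.ball y₀ (min r ρ), Metric.ball_mem_nhds y₀ (lt_min hr hρ), ?_⟩
  filter_upwards [Ioo_mem_nhdsGT hr] with ε hε
  have hsub : Icc 0 ε ×ˢ Metric.ball y₀ (min r ρ) ⊆ Metric.ball 0 r ×ˢ Metric.ball y₀ r :=
    prod_mono (fun e he => by simpa [abs_of_nonneg he.1] using he.2.trans_lt hε.2)
      (Metric.ball_subset_ball (min_le_left r ρ))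
  exact injOn_of_mixed_deriv_ne_zero (convex_ball y₀ _).ordConnected hε.1
    (fun q hq => (hball q (hsub hq)).1) (fun q hq => (hball q (hsub hq)).2.1)
    (fun q hq => (hball q (hsub hq)).2.2)
    (fun y hy => hball₀ y (Metric.ball_subset_ball (min_le_right r ρ) hy))

theorem exists_mul_neg_of_deriv_ne_zero {f : ℝ → ℝ} (hf : deriv f y₀ ≠ 0) (h0 : f y₀ = 0)
    {U : Set ℝ} (hU : U ∈ 𝓝 y₀) : ∃ y₁ ∈ U, ∃ y₂ ∈ U, f y₁ * f y₂ < 0 := by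
  have hev := (eventually_deriv_mul_mul_sub_pos hf h0).and (mem_nhdsWithin_of_mem_nhds hU)
  obtain ⟨y₁, ⟨h₁, hy₁⟩, hlt⟩ :=
    ((hev.filter_mono (nhdsLT_le_nhdsNE y₀)).and self_mem_nhdsWithin).exists
  obtain ⟨y₂, ⟨h₂, hy₂⟩, hgt⟩ :=
    ((hev.filter_mono (nhdsGT_le_nhdsNE y₀)).and self_mem_nhdsWithin).exists
  refine ⟨y₁, hy₁, y₂, hy₂, ?_⟩
  have hneg : deriv f y₀ * f y₁ < 0 := by nlinarith [sub_neg.2 hlt]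
  have hpos : 0 < deriv f y₀ * f y₂ := pos_of_mul_pos_left h₂ (sub_pos.2 hgt).le
  nlinarith [mul_self_pos.2 hf]

theorem eventually_exists_zero_of_deriv_ne_zero (hF : ContDiffAt ℝ 1 F (0, y₀))
    (hF0 : ∀ᶠ y in 𝓝 y₀, F (0, y) = 0) (hm : deriv (fun ε => F (ε, y₀)) 0 = 0)
    (hm' : deriv (fun y => deriv (fun ε => F (ε, y)) 0) y₀ ≠ 0) {U : Set ℝ} (hU : U ∈ 𝓝 y₀) :
    ∀ᶠ ε in 𝓝[>] 0, ∃ y ∈ U, F (ε, y) = 0 := by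
  have hcont : ∀ᶠ q in 𝓝 (0, y₀), ContinuousAt F q := by
    filter_upwards [hF.eventually (by simp)] with q hq using hq.continuousAt
  rw [nhds_prod_eq] at hcont
  obtain ⟨P, hP, Q, hQ, hPQ⟩ := eventually_prod_iff.1 hcont
  obtain ⟨r, hr, hball⟩ := Metric.eventually_nhds_iff_ball.1
    ((eventually_mem_set.2 hU).and (hQ.and hF0))
  obtain ⟨y₁, hy₁, y₂, hy₂, hneg⟩ :=
    exists_mul_neg_of_deriv_ne_zero hm' hm (Metric.ball_mem_nhds y₀ hr)
  have hsign : ∀ y ∈ Metric.ball y₀ r, deriv (fun ε => F (ε, y)) 0 ≠ 0 →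
      ∀ᶠ ε in 𝓝[>] 0, 0 < deriv (fun ε => F (ε, y)) 0 * F (ε, y) := fun y hy hne => by
    filter_upwards [nhdsGT_le_nhdsNE (0 : ℝ)
      (eventually_deriv_mul_mul_sub_pos hne (hball y hy).2.2), self_mem_nhdsWithin] with ε h hε
    exact pos_of_mul_pos_left h (sub_pos.2 hε).le
  filter_upwards [hsign y₁ hy₁ (left_ne_zero_of_mul hneg.ne),
    hsign y₂ hy₂ (right_ne_zero_of_mul hneg.ne), mem_nhdsWithin_of_mem_nhds hP] with ε h₁ h₂ hε
  have hFneg : F (ε, y₁) * F (ε, y₂) < 0 := by nlinarith [mul_pos h₁ h₂]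
  have hsub : uIcc y₁ y₂ ⊆ Metric.ball y₀ r :=
    (convex_ball y₀ r).ordConnected.uIcc_subset hy₁ hy₂
  have hco : ContinuousOn (fun y => F (ε, y)) (uIcc y₁ y₂) := fun y hy =>
    (ContinuousAt.comp (f := fun y => (ε, y)) (hPQ hε (hball y (hsub hy)).2.1)
      (continuousAt_const.prodMk continuousAt_id)).continuousWithinAt
  obtain ⟨y, hy, hFy⟩ := intermediate_value_uIcc hco (mem_uIcc.2 (by
    rcases mul_neg_iff.1 hFneg with h | h
    exacts [Or.inr ⟨h.2.le, h.1.le⟩, Or.inl ⟨h.1.le, h.2.le⟩]))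
  exact ⟨y, (hball y (hsub hy)).1, hFy⟩

end SimpleZero

/-! ### Cycles of arcs and their Poincaré maps -/

/-- A closed chain of `k` arcs of the `ε`-system, the arc `i` in the zone `z i` leading from the
crossing point `(x i, y i)` to `(x (i + 1), y (i + 1))`. The indices are taken modulo `k`, and the
zones and abscissas are parameters: the cycles near a given one share them. -/
structure Cycle (S : Sys) (ε : ℝ) {k : ℕ} (z : ZMod k → Zone) (x : ZMod k → ℝ) where
  y : ZMod k → ℝ
  γ : ZMod k → ℝ → ℝ × ℝ
  T : ZMod k → ℝ
  cross : ∀ i, S.IsCrossing ε (x i, y i)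
  arc : ∀ i, S.IsArc ε (z i) (x i, y i) (x (i + 1), y (i + 1)) (γ i) (T i)

namespace Sys

variable {S : Sys} {ε : ℝ}

theorem IsArc.field_start_ne_zero {z : Zone} {p q : ℝ × ℝ} {γ : ℝ → ℝ × ℝ} {T : ℝ}
    (h : S.IsArc ε z p q γ T) (hp : S.IsCrossing ε p) : (S.field ε z p).1 ≠ 0 := by
  obtain ⟨σ, hσ, -⟩ := h.exists_side_start hp.fst_eq
  exact hp.field_ne_zero hσ

theorem IsArc.field_end_ne_zero {z : Zone} {p q : ℝ × ℝ} {γ : ℝ → ℝ × ℝ} {T : ℝ}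
    (h : S.IsArc ε z p q γ T) (hq : S.IsCrossing ε q) : (S.field ε z q).1 ≠ 0 := by
  obtain ⟨σ, hσ, -⟩ := h.exists_side_end hq.fst_eq
  exact hq.field_ne_zero hσ

theorem IsCrossing.eventually {x y : ℝ} (h : S.IsCrossing ε (x, y)) :
    ∀ᶠ q : ℝ × ℝ in 𝓝 (ε, y), S.IsCrossing q.1 (x, q.2) := by
  have hc : ∀ z, Continuous fun q : ℝ × ℝ => (S.field q.1 z (x, q.2)).1 := fun z =>
    continuous_fst.comp ((S.continuous_field z).comp
      (f := fun q : ℝ × ℝ => (q.1, (x, q.2))) (by fun_prop))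
  rcases h with ⟨hx, h⟩ | ⟨hx, h⟩
  · filter_upwards [((hc Zone.C).mul (hc Zone.R)).continuousAt.eventually
      (eventually_gt_nhds h)] with q hq using Or.inl ⟨hx, hq⟩
  · filter_upwards [((hc Zone.L).mul (hc Zone.C)).continuousAt.eventually
      (eventually_gt_nhds h)] with q hq using Or.inr ⟨hx, hq⟩

end Sys

namespace Cycle

variable {S : Sys} {ε : ℝ} {k : ℕ} {z : ZMod k → Zone} {x : ZMod k → ℝ} (c : Cycle S ε z x)

/-- The crossing point at which the arc `i` starts. -/
def vertex (i : ZMod k) : ℝ × ℝ := (x i, c.y i)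

/-- The cycle as a subset of the plane. -/
def orbit : Set (ℝ × ℝ) := ⋃ i, c.γ i '' Icc 0 (c.T i)

theorem exists_transitionTime (i : ZMod k) :
    ∃ τ : ℝ × ℝ → ℝ, τ (ε, c.y i) = c.T i ∧ ContDiffAt ℝ 2 τ (ε, c.y i) ∧
      ∀ᶠ q : ℝ × ℝ in 𝓝 (ε, c.y i), S.IsArc q.1 (z i) (x i, q.2)
        (x (i + 1), (S.flow q.1 (z i) (τ q) (x i, q.2)).2)
        (fun t => S.flow q.1 (z i) t (x i, q.2)) (τ q) :=
  (c.arc i).exists_transitionTime (c.cross i).fst_eq (c.cross (i + 1)).fst_eq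
    ((c.arc i).field_start_ne_zero (c.cross i)) ((c.arc i).field_end_ne_zero (c.cross (i + 1)))

/-- The time spent on the arc `i` by the orbit of the `q.1`-system that starts at `(x i, q.2)`.
It is meaningful only for `q` near `(ε, c.y i)`. -/
noncomputable def transitionTime (i : ZMod k) : ℝ × ℝ → ℝ := (c.exists_transitionTime i).choose

theorem transitionTime_self (i : ZMod k) : c.transitionTime i (ε, c.y i) = c.T i :=
  (c.exists_transitionTime i).choose_spec.1

theorem contDiffAt_transitionTime (i : ZMod k) :
    ContDiffAt ℝ 2 (c.transitionTime i) (ε, c.y i) :=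
  (c.exists_transitionTime i).choose_spec.2.1

/-- The transition map along the arc `i`: the ordinate on `x = x (i + 1)` reached from
`(x i, q.2)` by the `q.1`-system. -/
noncomputable def transition (i : ZMod k) (q : ℝ × ℝ) : ℝ :=
  (S.flow q.1 (z i) (c.transitionTime i q) (x i, q.2)).2

/-- `(x i, q.2)` is a crossing point of the `q.1`-system, and its orbit follows the arc `i` of
the cycle. -/
def Regular (i : ZMod k) (q : ℝ × ℝ) : Prop :=
  S.IsCrossing q.1 (x i, q.2) ∧ S.IsArc q.1 (z i) (x i, q.2) (x (i + 1), c.transition i q)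
    (fun t => S.flow q.1 (z i) t (x i, q.2)) (c.transitionTime i q)

theorem eventually_regular (i : ZMod k) : ∀ᶠ q in 𝓝 (ε, c.y i), c.Regular i q :=
  (c.cross i).eventually.and (c.exists_transitionTime i).choose_spec.2.2

theorem transition_self (i : ZMod k) : c.transition i (ε, c.y i) = c.y (i + 1) := by
  rw [transition, transitionTime_self, ← congrFun (c.arc i).eq_flow, (c.arc i).term]

theorem contDiffAt_transition (i : ZMod k) : ContDiffAt ℝ 2 (c.transition i) (ε, c.y i) :=
  (ContDiffAt.comp (f := fun q : ℝ × ℝ => (q.1, c.transitionTime i q, (x i, q.2))) (ε, c.y i)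
    (S.contDiff_flow (z i)).contDiffAt (contDiffAt_fst.prodMk
      ((c.contDiffAt_transitionTime i).prodMk (contDiffAt_const.prodMk contDiffAt_snd)))).snd

/-- The ordinate reached from `(x 0, q.2)` after `n` arcs of the `q.1`-system. The Poincaré map
of the cycle is `ordinate k`. -/
noncomputable def ordinate : ℕ → ℝ × ℝ → ℝ
  | 0, q => q.2
  | n + 1, q => c.transition n (q.1, ordinate n q)

theorem ordinate_succ (n : ℕ) (q : ℝ × ℝ) :
    c.ordinate (n + 1) q = c.transition n (q.1, c.ordinate n q) := rfl

theorem ordinate_self (n : ℕ) : c.ordinate n (ε, c.y 0) = c.y n := by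
  induction n with
  | zero => simp only [ordinate, Nat.cast_zero]
  | succ n ih => rw [ordinate_succ, ih, transition_self, Nat.cast_succ]

theorem contDiffAt_ordinate (n : ℕ) : ContDiffAt ℝ 2 (c.ordinate n) (ε, c.y 0) := by
  induction n with
  | zero => exact contDiffAt_snd
  | succ n ih =>
    refine ContDiffAt.comp (f := fun q : ℝ × ℝ => (q.1, c.ordinate n q)) (ε, c.y 0) ?_
      (contDiffAt_fst.prodMk ih)
    simpa only [ordinate_self] using c.contDiffAt_transition n

theorem tendsto_ordinate (n : ℕ) :
    Tendsto (fun q : ℝ × ℝ => (q.1, c.ordinate n q)) (𝓝 (ε, c.y 0)) (𝓝 (ε, c.y n)) := by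
  have : ContinuousAt (fun q : ℝ × ℝ => (q.1, c.ordinate n q)) (ε, c.y 0) :=
    continuousAt_fst.prodMk (c.contDiffAt_ordinate n).continuousAt
  simpa only [ContinuousAt, ordinate_self] using this

theorem eventually_regular_ordinate :
    ∀ᶠ q in 𝓝 (ε, c.y 0), ∀ n < k, c.Regular n (q.1, c.ordinate n q) :=
  (finite_Iio k).eventually_all.2 fun n _ =>
    (c.tendsto_ordinate n).eventually (c.eventually_regular n)

variable {c}

theorem Regular.connects {n : ℕ} {q : ℝ × ℝ} (h : c.Regular n (q.1, c.ordinate n q)) :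
    S.Connects q.1 (z n) (x n, c.ordinate n q) (x (n + 1), c.ordinate (n + 1) q) :=
  ⟨_, _, h.2⟩

theorem Regular.unique {i : ZMod k} {q : ℝ × ℝ} (h : c.Regular i q) {w : Zone} {p : ℝ × ℝ}
    {γ : ℝ → ℝ × ℝ} {T : ℝ} (ha : S.IsArc q.1 w (x i, q.2) p γ T) (hp : p.1 = 1 ∨ p.1 = -1) :
    γ = (fun t => S.flow q.1 (z i) t (x i, q.2)) ∧ T = c.transitionTime i q ∧
      p = (x (i + 1), c.transition i q) := by
  obtain ⟨hc, hr⟩ := h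
  obtain ⟨σ, hσ, hσ'⟩ := ha.exists_side_start hc.fst_eq
  obtain ⟨ρ, hρ, hρ'⟩ := hr.exists_side_start hc.fst_eq
  obtain rfl := hc.zone_unique hρ hσ hρ' hσ'
  exact ha.unique hr hp (c.cross (i + 1)).fst_eq

theorem Regular.vertex_succ {e : ℝ} {n : ℕ} {w : ZMod n → Zone} {u : ZMod n → ℝ}
    {d : Cycle S e w u} {i : ZMod k} {s : ℝ} (h : c.Regular i (e, s)) {j : ZMod n}
    (hj : d.vertex j = (x i, s)) :
    d.γ j = (fun t => S.flow e (z i) t (x i, s)) ∧ d.T j = c.transitionTime i (e, s) ∧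
      d.vertex (j + 1) = (x (i + 1), c.transition i (e, s)) := by
  have ha := d.arc j
  rw [← vertex, hj] at ha
  exact h.unique ha (d.cross (j + 1)).fst_eq

end Cycle

/-! ### The first order expansion of the Poincaré map -/

namespace Cycle

variable {S : Sys} {k : ℕ} {z : ZMod k → Zone} {x : ZMod k → ℝ} (c : Cycle S 0 z x)

/-- The derivative at `ε = 0` of the ordinate reached after `n` arcs of the `ε`-system from the
starting point of the cycle. -/
noncomputable def firstVariation : ℕ → ℝ
  | 0 => 0
  | n + 1 => (S.lineInt (z n) (c.γ n) (c.T n) + (S.H (z n)).dy (x n, c.y n) * firstVariation n) /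
      (S.H (z n)).dy (x (n + 1), c.y (n + 1))

theorem dy_end_ne_zero (i : ZMod k) : (S.H (z i)).dy (x (i + 1), c.y (i + 1)) ≠ 0 :=
  Sys.field_zero_fst S .. ▸ (c.arc i).field_end_ne_zero (c.cross (i + 1))

theorem dy_start_ne_zero (i : ZMod k) : (S.H (z i)).dy (x i, c.y i) ≠ 0 :=
  Sys.field_zero_fst S .. ▸ (c.arc i).field_start_ne_zero (c.cross i)

theorem hasDerivAt_ordinate (n : ℕ) :
    HasDerivAt (fun ε => c.ordinate n (ε, c.y 0)) (c.firstVariation n) 0 := by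
  induction n with
  | zero => exact hasDerivAt_const _ _
  | succ n ih =>
    have hq : ContinuousAt (fun ε => (ε, c.ordinate n (ε, c.y 0))) 0 :=
      continuousAt_id.prodMk ih.continuousAt
    have h0 : (0, c.ordinate n (0, c.y 0)) = ((0 : ℝ), c.y n) := by rw [ordinate_self]
    have hτ : DifferentiableAt ℝ (fun ε => c.transitionTime n (ε, c.ordinate n (ε, c.y 0))) 0 :=
      DifferentiableAt.comp (f := fun ε => (ε, c.ordinate n (ε, c.y 0))) 0
        (h0.symm ▸ (c.contDiffAt_transitionTime n).differentiableAt two_ne_zero)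
        (differentiableAt_id.prodMk ih.differentiableAt)
    refine (c.arc n).hasDerivAt_end (c.dy_end_ne_zero n) hτ ?_ ih (c.ordinate_self n) ?_
    · rw [h0, transitionTime_self]
    · filter_upwards [hq.eventually (h0 ▸ c.eventually_regular n)] with ε hε
      exact congrArg Prod.fst hε.2.term

theorem isBigO_val_ordinate_sub (K : Ham) :
    (fun ε : ℝ => K.val (x 0, c.ordinate k (ε, c.y 0)) - K.val (x 0, c.y 0) -
      ε * (K.dy (x 0, c.y 0) * c.firstVariation k)) =O[𝓝[≥] 0] (fun ε : ℝ => ε ^ 2) := by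
  have h0 : c.ordinate k (0, c.y 0) = c.y 0 := by rw [ordinate_self, ZMod.natCast_self]
  have hP : ContDiffAt ℝ 2 (fun ε : ℝ => c.ordinate k (ε, c.y 0)) 0 :=
    ContDiffAt.comp (f := fun ε : ℝ => (ε, c.y 0)) 0 (c.contDiffAt_ordinate k)
      (contDiffAt_id.prodMk contDiffAt_const)
  have hK : ContDiffAt ℝ 2 (fun ε : ℝ => K.val (x 0, c.ordinate k (ε, c.y 0))) 0 := by
    unfold Ham.val
    fun_prop
  have hd := K.hasDerivAt_val_comp ((hasDerivAt_const (0 : ℝ) (x 0)).prodMk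
    (c.hasDerivAt_ordinate k))
  simpa only [h0, mul_zero, zero_add, sub_zero, smul_eq_mul] using
    isBigO_sub_sq_of_contDiffAt hK hd

end Cycle

/-! ### Periodic orbits as cycles -/

theorem apply_zmod_val_add_one {α : Type*} {n : ℕ} [NeZero n] {f : ℕ → α} (hf : f n = f 0)
    (i : ZMod n) : f (i + 1).val = f (i.val + 1) := by
  have hi : (i + 1).val = (i.val + 1) % n := by rw [ZMod.val_add, ZMod.val_one_eq_one_mod,
    Nat.add_mod_mod]
  rcases (Nat.succ_le_of_lt (ZMod.val_lt i)).lt_or_eq with hlt | heq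
  · rw [hi, Nat.mod_eq_of_lt hlt]
  · rw [hi, show i.val + 1 = n from heq, Nat.mod_self, hf]

theorem iUnion_zmod_val {α : Type*} {n : ℕ} [NeZero n] (s : ℕ → Set α) :
    ⋃ i : ZMod n, s i.val = ⋃ i ∈ Iio n, s i := by
  refine (iUnion_subset fun i => subset_biUnion_of_mem (u := s) (mem_Iio.2 i.val_lt)).antisymm
    (iUnion₂_subset fun i hi => ?_)
  exact subset_iUnion_of_subset (i : ZMod n) (by rw [ZMod.val_natCast_of_lt hi])

theorem Sys.IsCrossingPeriodicOrbit.exists_cycle {S : Sys} {ε : ℝ} {Γ : Set (ℝ × ℝ)}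
    (h : S.IsCrossingPeriodicOrbit ε Γ) :
    ∃ n : ℕ, ∃ _ : NeZero n, ∃ (z : ZMod n → Zone) (x : ZMod n → ℝ) (d : Cycle S ε z x),
      d.orbit = Γ := by
  obtain ⟨n, z, p, γ, T, hn, hp, ha, rfl⟩ := h
  have : NeZero n := ⟨hn.ne'⟩
  refine ⟨n, this, fun i => z i.val, fun i => (p i.val).1, ⟨fun i => (p i.val).2,
    fun i => γ i.val, fun i => T i.val, fun i => (ha _ i.val_lt).1, fun i => ?_⟩,
    iUnion_zmod_val fun i => γ i '' Icc 0 (T i)⟩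
  simpa only [apply_zmod_val_add_one hp] using (ha _ i.val_lt).2

namespace Cycle

variable {S : Sys} {ε : ℝ} {k : ℕ} [NeZero k] {z : ZMod k → Zone} {x : ZMod k → ℝ}

theorem isCrossingPeriodicOrbit_orbit (c : Cycle S ε z x) :
    S.IsCrossingPeriodicOrbit ε c.orbit := by
  refine ⟨k, fun i => z i, fun i => c.vertex i, fun i => c.γ i, fun i => c.T i, NeZero.pos k, ?_,
    fun i _ => ⟨c.cross i, ?_⟩, ?_⟩
  · simp only [ZMod.natCast_self, Nat.cast_zero]
  · simpa only [vertex, Nat.cast_succ] using c.arc i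
  · rw [← iUnion_zmod_val]
    simp only [ZMod.natCast_zmod_val, orbit]

theorem exists_cycle_of_ordinate_eq (c : Cycle S ε z x) {q : ℝ × ℝ}
    (hq : c.ordinate k q = q.2) (hreg : ∀ n < k, c.Regular n (q.1, c.ordinate n q)) :
    ∃ d : Cycle S q.1 z x, d.orbit = ⋃ n ∈ Iio k,
      (fun t => S.flow q.1 (z n) t (x n, c.ordinate n q)) ''
        Icc 0 (c.transitionTime n (q.1, c.ordinate n q)) := by
  have hreg' : ∀ i : ZMod k, c.Regular i (q.1, c.ordinate i.val q) := fun i => by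
    simpa only [ZMod.natCast_zmod_val] using hreg i.val i.val_lt
  have hsucc : ∀ i : ZMod k, c.ordinate (i + 1).val q =
      c.transition i (q.1, c.ordinate i.val q) := fun i => by
    rw [apply_zmod_val_add_one (f := fun n => c.ordinate n q) hq, ordinate_succ,
      ZMod.natCast_zmod_val]
  refine ⟨⟨fun i => c.ordinate i.val q, fun i t => S.flow q.1 (z i) t (x i, c.ordinate i.val q),
    fun i => c.transitionTime i (q.1, c.ordinate i.val q), fun i => (hreg' i).1,
    fun i => hsucc i ▸ (hreg' i).2⟩, ?_⟩
  rw [← iUnion_zmod_val]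
  simp only [ZMod.natCast_zmod_val, orbit]

theorem eventually_exists_cycle_subset (c : Cycle S ε z x) {U : Set (ℝ × ℝ)} (hU : IsOpen U)
    (hcU : c.orbit ⊆ U) :
    ∀ᶠ q in 𝓝 (ε, c.y 0), c.ordinate k q = q.2 → ∃ d : Cycle S q.1 z x, d.orbit ⊆ U := by
  have hflow : ∀ i, ∀ᶠ q in 𝓝 (ε, c.y i),
      (fun t => S.flow q.1 (z i) t (x i, q.2)) '' Icc 0 (c.transitionTime i q) ⊆ U := fun i => by
    refine S.eventually_flow_image_subset (z i) (c.contDiffAt_transitionTime i).continuousAt ?_ hU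
      ?_ <;> rw [transitionTime_self]
    · exact (c.arc i).pos
    · rw [← (c.arc i).eq_flow]
      exact (subset_iUnion (fun i => c.γ i '' Icc 0 (c.T i)) i).trans hcU
  filter_upwards [c.eventually_regular_ordinate, (finite_Iio k).eventually_all.2 fun n _ =>
    (c.tendsto_ordinate n).eventually (hflow n)] with q hreg hsub hq
  obtain ⟨d, hd⟩ := c.exists_cycle_of_ordinate_eq hq hreg
  exact ⟨d, hd ▸ iUnion₂_subset hsub⟩

theorem isCompact_orbit (c : Cycle S ε z x) : IsCompact c.orbit :=
  isCompact_iUnion fun i => isCompact_Icc.image (c.arc i).sol.continuous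

end Cycle

/-! ### No periodic orbits in a single zone near a cycle -/

theorem exists_nhds_forall_not_isOneZonePeriodicOrbit {S : Sys} {ε₀ : ℝ} {K : Set (ℝ × ℝ)}
    (hK : IsCompact K) (hleave : ∀ p ∈ K, ∀ w : Zone, ∃ t, S.flow ε₀ w t p ∉ closure w.region) :
    ∃ N : Set (ℝ × ℝ), IsOpen N ∧ K ⊆ N ∧
      ∀ᶠ ε in 𝓝 ε₀, ∀ Γ ⊆ N, ¬ S.IsOneZonePeriodicOrbit ε Γ := by
  have hopen : ∀ w : Zone, IsOpen
      {v : ℝ × (ℝ × ℝ) | ∃ t, S.flow v.1 w t v.2 ∉ closure w.region} := fun w => by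
    simp only [ofPred_exists]
    exact isOpen_iUnion fun t => isClosed_closure.isOpen_compl.preimage
      ((S.continuous_flow w).comp
        (f := fun v : ℝ × (ℝ × ℝ) => (v.1, t, v.2)) (by fun_prop))
  have hnhds : ∀ᶠ v : ℝ × (ℝ × ℝ) in 𝓝 ε₀ ×ˢ 𝓝ˢ K,
      ∀ w : Zone, ∃ t, S.flow v.1 w t v.2 ∉ closure w.region := by
    refine hK.mem_prod_nhdsSet_of_forall fun p hp => ?_
    rw [← nhds_prod_eq]
    have hev : ∀ w : Zone, ∀ᶠ v : ℝ × (ℝ × ℝ) in 𝓝 (ε₀, p),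
        ∃ t, S.flow v.1 w t v.2 ∉ closure w.region :=
      fun w => (hopen w).eventually_mem (x := (ε₀, p)) (hleave p hp w)
    filter_upwards [hev Zone.L, hev Zone.C, hev Zone.R] with v hL hC hR
    rintro (_ | _ | _)
    exacts [hL, hC, hR]
  obtain ⟨A, hA, B, hB, hAB⟩ := mem_prod_iff.1 hnhds
  obtain ⟨N, hNo, hN, hNB⟩ := mem_nhdsSet_iff_exists.1 hB
  refine ⟨N, hNo, hN, ?_⟩
  filter_upwards [hA] with ε hε Γ hΓ
  rintro ⟨w, γ, T, -, hsol, -, -, hcl, rfl⟩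
  obtain ⟨t, ht⟩ := hAB (mk_mem_prod hε (hNB (hΓ (mem_range_self 0)))) w
  rw [hsol.flow_apply] at ht
  exact ht (hcl _)

theorem Cycle.exists_flow_notMem_closure {S : Sys} {ε : ℝ} {k : ℕ} {z : ZMod k → Zone}
    {x : ZMod k → ℝ} (c : Cycle S ε z x) {p : ℝ × ℝ} (hp : p ∈ c.orbit) (w : Zone) :
    ∃ t, S.flow ε w t p ∉ closure w.region := by
  obtain ⟨i, s, hs, rfl⟩ := mem_iUnion.1 hp
  rcases eq_endpoints_or_mem_Ioo_of_mem_Icc hs with rfl | rfl | hs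
  · exact (c.arc i).init ▸ (c.cross i).exists_flow_notMem_closure w
  · exact (c.arc i).term ▸ (c.cross (i + 1)).exists_flow_notMem_closure w
  by_cases hw : c.γ i s ∈ closure w.region
  · obtain rfl := eq_of_mem_region_of_mem_closure ((c.arc i).inside s hs) hw
    obtain ⟨t, ht⟩ := (c.cross (i + 1)).exists_flow_notMem_closure (z i)
    rw [← (c.arc i).term, (c.arc i).sol.flow_apply] at ht
    refine ⟨t + c.T i - s, ?_⟩
    rwa [(c.arc i).sol.flow_apply, sub_add_cancel]
  · exact ⟨0, by rwa [S.flow_zero]⟩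

section Confinement

open Metric

/-! ### Confinement of the periodic orbits near a cycle -/

theorem eventually_forall_mem_ball {α β : Type*} [TopologicalSpace α] [PseudoMetricSpace β]
    {a : α} {b : β} {p : α × β → Prop} (h : ∀ᶠ q in 𝓝 (a, b), p q) :
    ∀ᶠ ρ in 𝓝[>] (0 : ℝ), ∀ᶠ e in 𝓝 a, ∀ s ∈ ball b ρ, p (e, s) := by
  rw [nhds_prod_eq] at h
  obtain ⟨A, hA, B, hB, hAB⟩ := eventually_prod_iff.1 h
  obtain ⟨r, hr, hball⟩ := eventually_nhds_iff_ball.1 hB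
  filter_upwards [Ioo_mem_nhdsGT hr] with ρ hρ
  exact hA.mono fun e he s hs => hAB he (hball s (ball_subset_ball hρ.2.le hs))

theorem eq_of_periodic_of_strictMonoOn {α : Type*} [LinearOrder α] {f : α → α} {s : Set α}
    (hf : StrictMonoOn f s) {u : ℕ → α} (hu : ∀ l, u l ∈ s) (hstep : ∀ l, u (l + 1) = f (u l))
    {n : ℕ} (hn : 0 < n) (hper : u n = u 0) : u 1 = u 0 := by
  rcases lt_trichotomy (u 0) (u 1) with h | h | h
  · have hlt : ∀ l, u l < u (l + 1) := fun l => by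
      induction l with
      | zero => exact h
      | succ l ih => simpa only [hstep] using hf (hu _) (hu _) ih
    exact absurd hper (strictMono_nat_of_lt_succ hlt hn).ne'
  · exact h.symm
  · have hlt : ∀ l, u (l + 1) < u l := fun l => by
      induction l with
      | zero => exact h
      | succ l ih => simpa only [hstep] using hf (hu _) (hu _) ih
    exact absurd hper (strictAnti_nat_of_succ_lt hlt hn).ne

namespace Cycle

variable {S : Sys} {ε₀ : ℝ} {k : ℕ} {z : ZMod k → Zone} {x : ZMod k → ℝ} {c : Cycle S ε₀ z x}

variable (c) in
/-- Inside the balls of radius `ρ` about the vertices of the cycle `c`, the `ε`-system follows the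
arcs of `c`, an arc that starts in one ball can end in no ball but that of the next vertex, and
the Poincaré map is increasing. -/
structure Confined (ε ρ : ℝ) : Prop where
  le_one : ρ ≤ 1
  regular : ∀ i, ∀ s ∈ ball (c.y i) ρ, c.Regular i (ε, s)
  next : ∀ i j, ∀ s ∈ ball (c.y i) ρ,
    (x (i + 1), c.transition i (ε, s)) ∈ ball (c.vertex j) ρ → c.vertex j = c.vertex (i + 1)
  mono : StrictMonoOn (fun s => c.ordinate k (ε, s)) (ball (c.y 0) ρ)

theorem eventually_transition_notMem_ball {i j : ZMod k} (hij : c.vertex j ≠ c.vertex (i + 1)) :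
    ∀ᶠ ρ in 𝓝[>] (0 : ℝ), ∀ᶠ ε in 𝓝 ε₀, ∀ s ∈ ball (c.y i) ρ,
      (x (i + 1), c.transition i (ε, s)) ∉ ball (c.vertex j) ρ := by
  have hcont : ContinuousAt (fun q => dist (x (i + 1), c.transition i q) (c.vertex j))
      (ε₀, c.y i) :=
    Tendsto.dist (continuousAt_const.prodMk (c.contDiffAt_transition i).continuousAt).tendsto
      tendsto_const_nhds
  have hpos : 0 < dist (x (i + 1), c.transition i (ε₀, c.y i)) (c.vertex j) := by
    rw [transition_self]
    exact dist_pos.2 hij.symm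
  filter_upwards [eventually_forall_mem_ball (hcont.eventually (eventually_gt_nhds
    (half_lt_self hpos))), Ioo_mem_nhdsGT (half_pos hpos)] with ρ hfar hρ
  exact hfar.mono fun ε hε s hs hmem => (hε s hs).not_ge ((mem_ball.1 hmem).trans hρ.2).le

theorem eventually_strictMonoOn_ordinate (hP : ∀ᶠ s in 𝓝 (c.y 0), c.ordinate k (ε₀, s) = s) :
    ∀ᶠ ρ in 𝓝[>] (0 : ℝ), ∀ᶠ ε in 𝓝 ε₀,
      StrictMonoOn (fun s => c.ordinate k (ε, s)) (ball (c.y 0) ρ) := by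
  have hC : ContDiffAt ℝ 2 (c.ordinate k) (ε₀, c.y 0) := c.contDiffAt_ordinate k
  have hderiv := eventually_hasDerivAt_right (hC.of_le one_le_two)
  have hone : fderiv ℝ (c.ordinate k) (ε₀, c.y 0) (0, 1) = 1 :=
    hderiv.self_of_nhds.unique ((hasDerivAt_id (c.y 0)).congr_of_eventuallyEq hP)
  have hpos : ∀ᶠ q in 𝓝 (ε₀, c.y 0), 0 < fderiv ℝ (c.ordinate k) q (0, 1) :=
    (contDiffAt_fderiv_apply hC (0, 1)).continuousAt.eventually
      (eventually_gt_nhds (zero_lt_one.trans_eq hone.symm))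
  filter_upwards [eventually_forall_mem_ball (hderiv.and hpos)] with ρ hρ
  filter_upwards [hρ] with ε hε
  refine strictMonoOn_of_deriv_pos (convex_ball _ _)
    (fun s hs => (hε s hs).1.continuousAt.continuousWithinAt) fun s hs => ?_
  rw [isOpen_ball.interior_eq] at hs
  exact (hε s hs).1.deriv.symm ▸ (hε s hs).2

theorem eventually_confined [NeZero k] (hP : ∀ᶠ s in 𝓝 (c.y 0), c.ordinate k (ε₀, s) = s) :
    ∀ᶠ ρ in 𝓝[>] (0 : ℝ), ∀ᶠ ε in 𝓝 ε₀, c.Confined ε ρ := by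
  have hnext : ∀ i j, ∀ᶠ ρ in 𝓝[>] (0 : ℝ), ∀ᶠ ε in 𝓝 ε₀, ∀ s ∈ ball (c.y i) ρ,
      (x (i + 1), c.transition i (ε, s)) ∈ ball (c.vertex j) ρ →
        c.vertex j = c.vertex (i + 1) := fun i j => by
    by_cases hij : c.vertex j = c.vertex (i + 1)
    · exact .of_forall fun _ => .of_forall fun _ _ _ _ => hij
    · exact (eventually_transition_notMem_ball hij).mono fun ρ hρ =>
        hρ.mono fun ε hε s hs hmem => absurd hmem (hε s hs)
  filter_upwards [eventually_all.2 fun i => eventually_forall_mem_ball (c.eventually_regular i),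
    eventually_all.2 fun i => eventually_all.2 (hnext i), eventually_strictMonoOn_ordinate hP,
    Ioo_mem_nhdsGT one_pos] with ρ hregular hnext hmono hρ
  filter_upwards [eventually_all.2 hregular,
    eventually_all.2 fun i => eventually_all.2 (hnext i), hmono] with ε hregular hnext hmono
  exact ⟨hρ.2.le, hregular, hnext, hmono⟩

variable {ε ρ : ℝ} {n : ℕ} {w : ZMod n → Zone} {u : ZMod n → ℝ} {d : Cycle S ε w u}

theorem Confined.vertex_eq (hC : c.Confined ε ρ) {i : ZMod k} {j : ZMod n}
    (h : d.vertex j ∈ ball (c.vertex i) ρ) :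
    d.vertex j = (x i, d.y j) ∧ d.y j ∈ ball (c.y i) ρ := by
  rw [vertex, vertex, ← ball_prod_same] at h
  refine ⟨Prod.ext ?_ rfl, h.2⟩
  have hlt : |u j - x i| < 1 := (mem_ball.1 h.1).trans_le hC.le_one
  have hu : u j = 1 ∨ u j = -1 := (d.cross j).fst_eq
  have hx : x i = 1 ∨ x i = -1 := (c.cross i).fst_eq
  change u j = x i
  rcases hu with hu | hu <;> rcases hx with hx | hx <;> rw [hu, hx] at hlt ⊢ <;> norm_num at hlt

theorem Confined.vertex_succ_mem_ball (hC : c.Confined ε ρ)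
    (hd : ∀ j, ∃ i, d.vertex j ∈ ball (c.vertex i) ρ) {i : ZMod k} {j : ZMod n}
    (h : d.vertex j ∈ ball (c.vertex i) ρ) : d.vertex (j + 1) ∈ ball (c.vertex (i + 1)) ρ := by
  obtain ⟨heq, hmem⟩ := hC.vertex_eq h
  obtain ⟨l, hl⟩ := hd (j + 1)
  have hsucc := ((hC.regular i _ hmem).vertex_succ heq).2.2
  rwa [← hC.next i l _ hmem (hsucc ▸ hl)]

theorem Confined.exists_forall_vertex_mem_ball [NeZero k] (hC : c.Confined ε ρ)
    (hd : ∀ j, ∃ i, d.vertex j ∈ ball (c.vertex i) ρ) :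
    ∃ m : ZMod n, ∀ j : ℕ, d.vertex (m + j) ∈ ball (c.vertex j) ρ := by
  obtain ⟨i, hi⟩ := hd 0
  have hmem : ∀ l : ℕ, d.vertex l ∈ ball (c.vertex (i + l)) ρ := fun l => by
    induction l with
    | zero => simpa only [Nat.cast_zero, add_zero] using hi
    | succ l ih => simpa only [Nat.cast_succ, add_assoc] using hC.vertex_succ_mem_ball hd ih
  refine ⟨(-i).val, fun j => ?_⟩
  simpa only [Nat.cast_add, ZMod.natCast_zmod_val, add_neg_cancel_left] using
    hmem ((-i).val + j)

theorem Confined.regular_of_vertex_eq (hC : c.Confined ε ρ) {i : ZMod k} {j : ZMod n} {s : ℝ}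
    (h : d.vertex j ∈ ball (c.vertex i) ρ) (hs : d.vertex j = (x i, s)) : c.Regular i (ε, s) := by
  rw [hs, vertex, ← ball_prod_same] at h
  exact hC.regular i s h.2

theorem Confined.vertex_add_eq (hC : c.Confined ε ρ) {m : ZMod n}
    (hm : ∀ j : ℕ, d.vertex (m + j) ∈ ball (c.vertex j) ρ) (j : ℕ) :
    d.vertex (m + j) = (x j, c.ordinate j (ε, d.y m)) := by
  induction j with
  | zero => simpa only [Nat.cast_zero, add_zero, ordinate] using (hC.vertex_eq (hm 0)).1
  | succ j ih =>
    simpa only [Nat.cast_succ, add_assoc, ordinate_succ] using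
      ((hC.regular_of_vertex_eq (hm j) ih).vertex_succ ih).2.2

theorem Confined.ordinate_eq [NeZero n] (hC : c.Confined ε ρ) {m : ZMod n}
    (hm : ∀ j : ℕ, d.vertex (m + j) ∈ ball (c.vertex j) ρ) :
    c.ordinate k (ε, d.y m) = d.y m := by
  have hshift : ∀ l j : ℕ, d.vertex (m + (k * l : ℕ) + j) ∈ ball (c.vertex j) ρ := fun l j => by
    simpa only [Nat.cast_add, Nat.cast_mul, ZMod.natCast_self, zero_mul, zero_add, add_assoc]
      using hm (k * l + j)
  have hstep : ∀ l : ℕ, d.y (m + (k * (l + 1) : ℕ)) = c.ordinate k (ε, d.y (m + (k * l : ℕ))) :=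
    fun l => by
      simpa only [Nat.mul_succ, Nat.cast_add, add_assoc, vertex] using
        congrArg Prod.snd (hC.vertex_add_eq (hshift l) k)
  have hmem : ∀ l : ℕ, d.y (m + (k * l : ℕ)) ∈ ball (c.y 0) ρ := fun l => by
    simpa only [Nat.cast_zero, add_zero] using (hC.vertex_eq (hshift l 0)).2
  have hfix := eq_of_periodic_of_strictMonoOn hC.mono hmem hstep (NeZero.pos n) (by
    simp only [mul_zero, Nat.cast_zero, Nat.cast_mul, ZMod.natCast_self])
  have h0 := hstep 0
  rw [zero_add] at h0
  rw [h0] at hfix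
  simpa only [mul_zero, Nat.cast_zero, add_zero] using hfix

variable (c) in
/-- The orbit of the `q.1`-system that starts at `(x 0, q.2)` and follows the arcs of `c` again
and again. -/
def trace (q : ℝ × ℝ) : Set (ℝ × ℝ) :=
  ⋃ j : ℕ, (fun t => S.flow q.1 (z j) t (x j, c.ordinate j q)) ''
    Icc 0 (c.transitionTime j (q.1, c.ordinate j q))

theorem Confined.orbit_eq_trace [NeZero n] (hC : c.Confined ε ρ) {m : ZMod n}
    (hm : ∀ j : ℕ, d.vertex (m + j) ∈ ball (c.vertex j) ρ) :
    d.orbit = c.trace (ε, d.y m) := by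
  have hsurj : Function.Surjective fun j : ℕ => m + (j : ZMod n) :=
    (AddGroup.addLeft_bijective m).surjective.comp ZMod.natCast_zmod_surjective
  rw [orbit, trace, ← hsurj.iUnion_comp]
  refine iUnion_congr fun j => ?_
  have hv := hC.vertex_add_eq hm j
  obtain ⟨hγ, hT, -⟩ := (hC.regular_of_vertex_eq (hm j) hv).vertex_succ hv
  rw [hγ, hT]

/-- A periodic orbit whose vertices stay near those of `c` might wind around several times; as the
Poincaré map is increasing, it closes up after one turn. -/
theorem Confined.exists_orbit_eq_trace [NeZero k] [NeZero n] (hC : c.Confined ε ρ)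
    (hd : ∀ j, ∃ i, d.vertex j ∈ ball (c.vertex i) ρ) :
    ∃ s ∈ ball (c.y 0) ρ, c.ordinate k (ε, s) = s ∧ d.orbit = c.trace (ε, s) := by
  obtain ⟨m, hm⟩ := hC.exists_forall_vertex_mem_ball hd
  have hmem : d.y m ∈ ball (c.y 0) ρ := by
    simpa only [Nat.cast_zero, add_zero] using (hC.vertex_eq (hm 0)).2
  exact ⟨d.y m, hmem, hC.ordinate_eq hm, hC.orbit_eq_trace hm⟩

end Cycle

/-! ### The unique limit cycle near a cycle -/

theorem Sys.uniqueLimitCycleNear_of_eventually {S : Sys} {L U₀ : Set (ℝ × ℝ)} (hU₀ : IsOpen U₀)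
    (hL : L ⊆ U₀)
    (huniq : ∀ᶠ ε in 𝓝[>] (0 : ℝ), ∀ Γ ⊆ U₀, ∀ Γ' ⊆ U₀,
      S.IsPeriodicOrbit ε Γ → S.IsPeriodicOrbit ε Γ' → Γ' = Γ)
    (hex : ∀ U, IsOpen U → L ⊆ U →
      ∀ᶠ ε in 𝓝[>] (0 : ℝ), ∃ Γ ⊆ U, S.IsCrossingPeriodicOrbit ε Γ) :
    S.UniqueLimitCycleNear L := by
  refine ⟨U₀, hU₀, hL, fun U hU hLU => ?_⟩
  obtain ⟨ε₀, hε₀, h⟩ := mem_nhdsGT_iff_exists_Ioo_subset.1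
    (huniq.and (hex (U₀ ∩ U) (hU₀.inter hU) (subset_inter hL hLU)))
  refine ⟨ε₀, hε₀, fun ε hε => ?_⟩
  obtain ⟨huniq, Γ, hΓU, hΓ⟩ := h hε
  obtain ⟨hΓU₀, hΓU⟩ := subset_inter_iff.1 hΓU
  have hunique : ∀ Γ' ⊆ U₀, S.IsPeriodicOrbit ε Γ' → Γ' = Γ := fun Γ' hΓ' =>
    huniq Γ hΓU₀ Γ' hΓ' (.inl hΓ)
  exact ⟨Γ, hΓU₀, hΓU, ⟨hΓ, U₀, hU₀, hΓU₀, hunique⟩, hunique⟩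

namespace Cycle

variable {S : Sys} {ε₀ : ℝ} {k : ℕ} {z : ZMod k → Zone} {x : ZMod k → ℝ}

/-- A neighbourhood of the cycle `c` which meets the switching lines only in the balls of
radius `ρ` about the vertices of `c`. -/
def tube (c : Cycle S ε₀ z x) (ρ : ℝ) : Set (ℝ × ℝ) :=
  {p | p.1 ≠ 1 ∧ p.1 ≠ -1} ∪ ⋃ i, ball (c.vertex i) ρ

theorem isOpen_tube (c : Cycle S ε₀ z x) (ρ : ℝ) : IsOpen (c.tube ρ) :=
  ((isOpen_ne_fun continuous_fst continuous_const).inter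
    (isOpen_ne_fun continuous_fst continuous_const)).union (isOpen_iUnion fun _ => isOpen_ball)

theorem orbit_subset_tube (c : Cycle S ε₀ z x) {ρ : ℝ} (hρ : 0 < ρ) : c.orbit ⊆ c.tube ρ := by
  refine iUnion_subset fun i => ?_
  rintro _ ⟨s, hs, rfl⟩
  rcases eq_endpoints_or_mem_Ioo_of_mem_Icc hs with rfl | rfl | hs
  · exact .inr (mem_iUnion.2 ⟨i, (c.arc i).init ▸ mem_ball_self hρ⟩)
  · exact .inr (mem_iUnion.2 ⟨i + 1, (c.arc i).term ▸ mem_ball_self hρ⟩)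
  · exact .inl (not_or.1 fun hline => notMem_region_of_line hline _ ((c.arc i).inside s hs))

theorem vertex_mem_orbit (c : Cycle S ε₀ z x) (i : ZMod k) : c.vertex i ∈ c.orbit :=
  mem_iUnion.2 ⟨i, 0, left_mem_Icc.2 (c.arc i).pos.le, (c.arc i).init⟩

theorem exists_vertex_mem_ball {c : Cycle S ε₀ z x} {ε ρ : ℝ} {n : ℕ} {w : ZMod n → Zone}
    {u : ZMod n → ℝ} {d : Cycle S ε w u} (h : d.orbit ⊆ c.tube ρ) (j : ZMod n) :
    ∃ i, d.vertex j ∈ ball (c.vertex i) ρ :=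
  (h (d.vertex_mem_orbit j)).elim (fun hne => absurd (d.cross j).fst_eq (not_or.2 hne))
    mem_iUnion.1

theorem Confined.eq_of_subset_tube [NeZero k] {c : Cycle S ε₀ z x} {ε ρ : ℝ}
    (hC : c.Confined ε ρ) (hinj : InjOn (fun s => c.ordinate k (ε, s) - s) (ball (c.y 0) ρ))
    {Γ Γ' : Set (ℝ × ℝ)} (hΓ : S.IsCrossingPeriodicOrbit ε Γ)
    (hΓ' : S.IsCrossingPeriodicOrbit ε Γ') (h : Γ ⊆ c.tube ρ) (h' : Γ' ⊆ c.tube ρ) : Γ' = Γ := by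
  obtain ⟨n, _, w, u, d, rfl⟩ := hΓ.exists_cycle
  obtain ⟨n', _, w', u', d', rfl⟩ := hΓ'.exists_cycle
  obtain ⟨s, hs, hfix, heq⟩ := hC.exists_orbit_eq_trace (exists_vertex_mem_ball h)
  obtain ⟨s', hs', hfix', heq'⟩ := hC.exists_orbit_eq_trace (exists_vertex_mem_ball h')
  have hss : s' = s := hinj hs' hs (by simp only [hfix, hfix', sub_self])
  rw [heq, heq', hss]

theorem uniqueLimitCycleNear [NeZero k] (c : Cycle S 0 z x)
    (hP : ∀ᶠ s in 𝓝 (c.y 0), c.ordinate k (0, s) = s)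
    (hm : deriv (fun ε => c.ordinate k (ε, c.y 0)) 0 = 0)
    (hm' : deriv (fun s => deriv (fun ε => c.ordinate k (ε, s)) 0) (c.y 0) ≠ 0) :
    S.UniqueLimitCycleNear c.orbit := by
  have hF : ContDiffAt ℝ 2 (fun q => c.ordinate k q - q.2) (0, c.y 0) :=
    (c.contDiffAt_ordinate k).sub contDiffAt_snd
  have hF0 : ∀ᶠ s in 𝓝 (c.y 0), c.ordinate k (0, s) - s = 0 := hP.mono fun s => sub_eq_zero.2
  have hFm : deriv (fun ε => c.ordinate k (ε, c.y 0) - c.y 0) 0 = 0 := by rwa [deriv_sub_const]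
  have hFm' : deriv (fun s => deriv (fun ε => c.ordinate k (ε, s) - s) 0) (c.y 0) ≠ 0 := by
    simpa only [deriv_sub_const] using hm'
  obtain ⟨V, hV, hinj⟩ := exists_eventually_injOn_of_mixed_deriv_ne_zero hF hF0 hFm'
  obtain ⟨r, hr, hrV⟩ := Metric.mem_nhds_iff.1 hV
  obtain ⟨ρ, hconf, hρ⟩ := ((eventually_confined hP).and (Ioo_mem_nhdsGT hr)).exists
  obtain ⟨N, hN, hcN, hone⟩ := exists_nhds_forall_not_isOneZonePeriodicOrbit c.isCompact_orbit
    fun p hp => c.exists_flow_notMem_closure hp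
  refine Sys.uniqueLimitCycleNear_of_eventually ((c.isOpen_tube ρ).inter hN)
    (subset_inter (c.orbit_subset_tube hρ.1) hcN) ?_ fun U hU hcU => ?_
  · filter_upwards [hinj, nhdsWithin_le_nhds hconf, nhdsWithin_le_nhds hone]
      with ε hinj hconf hone Γ hΓ Γ' hΓ' hper hper'
    rw [subset_inter_iff] at hΓ hΓ'
    exact hconf.eq_of_subset_tube (hinj.mono ((ball_subset_ball hρ.2.le).trans hrV))
      (hper.resolve_right (hone Γ hΓ.2)) (hper'.resolve_right (hone Γ' hΓ'.2)) hΓ.1 hΓ'.1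
  · obtain ⟨ρ', hclose, hρ'⟩ := ((eventually_forall_mem_ball
      (c.eventually_exists_cycle_subset hU hcU)).and self_mem_nhdsWithin).exists
    filter_upwards [eventually_exists_zero_of_deriv_ne_zero (hF.of_le one_le_two) hF0 hFm hFm'
      (ball_mem_nhds _ hρ'), nhdsWithin_le_nhds hclose] with ε ⟨s, hs, hzero⟩ hclose
    obtain ⟨d, hd⟩ := hclose s hs (sub_eq_zero.1 hzero)
    exact ⟨d.orbit, hd, d.isCrossingPeriodicOrbit_orbit⟩

end Cycle

end Confinement

/-! ### Periodic annuli -/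

theorem image_mem_nhds_of_injOn {a : ℝ → ℝ} {h : ℝ} {V : Set ℝ} (hV : V ∈ 𝓝 h)
    (ha : ContinuousOn a V) (hinj : InjOn a V) : a '' V ∈ 𝓝 (a h) := by
  obtain ⟨l, u, ⟨hl, hu⟩, hsub⟩ := mem_nhds_iff_exists_Ioo_subset.1 hV
  obtain ⟨l', hl'⟩ := exists_between hl
  obtain ⟨u', hu'⟩ := exists_between hu
  have hIcc : Icc l' u' ⊆ V := (Icc_subset_Ioo hl'.1 hu'.2).trans hsub
  have hle : l' ≤ u' := (hl'.2.trans hu'.1).le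
  have hmem : h ∈ Icc l' u' := ⟨hl'.2.le, hu'.1.le⟩
  have hc := ha.mono hIcc
  rcases hc.strictMonoOn_of_injOn_Icc' hle (hinj.mono hIcc) with hmono | hanti
  · exact mem_of_superset (Icc_mem_nhds (hmono (left_mem_Icc.2 hle) hmem hl'.2)
      (hmono hmem (right_mem_Icc.2 hle) hu'.1))
      ((intermediate_value_Icc hle hc).trans (image_mono hIcc))
  · exact mem_of_superset (Icc_mem_nhds (hanti hmem (right_mem_Icc.2 hle) hu'.1)
      (hanti (left_mem_Icc.2 hle) hmem hl'.2))
      ((intermediate_value_Icc' hle hc).trans (image_mono hIcc))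

namespace Cycle

variable {S : Sys} {k : ℕ} {z : ZMod k → Zone} {x : ZMod k → ℝ}

theorem ordinate_eq_of_regular {ε₁ ε₂ : ℝ} {c : Cycle S ε₁ z x} {d : Cycle S ε₂ z x} {q : ℝ × ℝ}
    (hc : ∀ n < k, c.Regular n (q.1, c.ordinate n q))
    (hd : ∀ n < k, d.Regular n (q.1, d.ordinate n q)) {n : ℕ} (hn : n ≤ k) :
    d.ordinate n q = c.ordinate n q := by
  induction n with
  | zero => rfl
  | succ n ih =>
    have harc := (hd n hn).2
    rw [ih (Nat.le_of_succ_le hn)] at harc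
    rw [ordinate_succ, ordinate_succ, ih (Nat.le_of_succ_le hn)]
    exact (Prod.ext_iff.1 ((hc n hn).unique harc (d.cross (n + 1)).fst_eq).2.2).2

end Cycle

/-- An open family of cycles of the unperturbed system with the same zones and abscissas,
parametrized by `h ∈ J`. The cycle of `h` starts at `(x 0, a h)`. -/
structure PeriodicAnnulus (S : Sys) {k : ℕ} (z : ZMod k → Zone) (x : ZMod k → ℝ) where
  J : Set ℝ
  a : ℝ → ℝ
  isOpen : IsOpen J
  differentiableOn : DifferentiableOn ℝ a J
  injOn : InjOn a J
  cycle : ∀ h ∈ J, Cycle S 0 z x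
  cycle_y_zero : ∀ h hh, (cycle h hh).y 0 = a h

namespace PeriodicAnnulus

variable {S : Sys} {k : ℕ} {z : ZMod k → Zone} {x : ZMod k → ℝ} (D : PeriodicAnnulus S z x)

theorem isMelnikov {K : Ham} {ret : ℝ → ℝ → ℝ → Prop} {M : ℝ → ℝ}
    (hret : ∀ (c : Cycle S 0 z x) (q : ℝ × ℝ),
      (∀ n < k, c.Regular n (q.1, c.ordinate n q)) → ret q.1 q.2 (c.ordinate k q))
    (hM : ∀ h hh, M h = K.dy (x 0, D.a h) * (D.cycle h hh).firstVariation k) :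
    Sys.IsMelnikov K (x 0) ret D.J D.a M := by
  intro h hh
  have hline : Tendsto (fun ε : ℝ => (ε, D.a h)) (𝓝[≥] 0) (𝓝 (0, (D.cycle h hh).y 0)) := by
    rw [D.cycle_y_zero]
    exact (Continuous.prodMk_left (D.a h)).continuousWithinAt
  obtain ⟨ε₀, hε₀, hreg⟩ := mem_nhdsGE_iff_exists_Ico_subset.1
    (hline.eventually (D.cycle h hh).eventually_regular_ordinate)
  refine ⟨ε₀, hε₀, fun ε => (D.cycle h hh).ordinate k (ε, D.a h),
    fun ε hε => hret _ (ε, D.a h) (hreg hε), ?_⟩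
  rw [hM h hh]
  simpa only [D.cycle_y_zero] using (D.cycle h hh).isBigO_val_ordinate_sub K

variable {D} {h : ℝ} (hh : h ∈ D.J)

theorem eventually_ordinate_eventuallyEq :
    ∀ᶠ h' in 𝓝 h, ∀ hh' : h' ∈ D.J,
      (D.cycle h' hh').ordinate k =ᶠ[𝓝 (0, D.a h')] (D.cycle h hh).ordinate k := by
  have ha : Tendsto (fun h' => ((0 : ℝ), D.a h')) (𝓝 h) (𝓝 (0, (D.cycle h hh).y 0)) := by
    rw [D.cycle_y_zero]
    exact continuousAt_const.prodMk
      (D.differentiableOn.continuousOn.continuousAt (D.isOpen.mem_nhds hh))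
  filter_upwards [ha.eventually (D.cycle h hh).eventually_regular_ordinate.eventually_nhds]
    with h' hreg hh'
  have hreg' := (D.cycle h' hh').eventually_regular_ordinate
  rw [D.cycle_y_zero] at hreg'
  filter_upwards [hreg, hreg'] with q hq hq' using Cycle.ordinate_eq_of_regular hq hq' le_rfl

theorem eventually_ordinate_eq_self :
    ∀ᶠ s in 𝓝 (D.a h), (D.cycle h hh).ordinate k (0, s) = s := by
  have hev := (D.isOpen.eventually_mem hh).and (eventually_ordinate_eventuallyEq hh)
  refine mem_of_superset (image_mem_nhds_of_injOn hev
    (D.differentiableOn.continuousOn.mono fun _ hs => hs.1) (D.injOn.mono fun _ hs => hs.1)) ?_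
  rintro _ ⟨h', ⟨hh', heq⟩, rfl⟩
  have hself := (D.cycle h' hh').ordinate_self k
  rwa [D.cycle_y_zero, ZMod.natCast_self, D.cycle_y_zero, (heq hh').self_of_nhds] at hself

theorem eventually_firstVariation_eq :
    ∀ᶠ h' in 𝓝 h, ∀ hh' : h' ∈ D.J, (D.cycle h' hh').firstVariation k =
      deriv (fun ε => (D.cycle h hh).ordinate k (ε, D.a h')) 0 := by
  filter_upwards [eventually_ordinate_eventuallyEq hh] with h' heq hh'
  have hd := ((D.cycle h' hh').hasDerivAt_ordinate k).deriv
  rw [D.cycle_y_zero] at hd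
  rw [← hd]
  exact Filter.EventuallyEq.deriv_eq
    ((Continuous.prodMk_left (D.a h')).continuousAt.eventually (heq hh'))

theorem uniqueLimitCycleNear [NeZero k] {M : ℝ → ℝ}
    (hM : ∀ h hh, M h = (S.H (z 0)).dy (x 0, D.a h) * (D.cycle h hh).firstVariation k)
    (h0 : M h = 0) (h1 : deriv M h ≠ 0) : S.UniqueLimitCycleNear (D.cycle h hh).orbit := by
  have hy : (D.cycle h hh).y 0 = D.a h := D.cycle_y_zero h hh
  let m : ℝ → ℝ := fun s => deriv (fun ε => (D.cycle h hh).ordinate k (ε, s)) 0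
  have ha : DifferentiableAt ℝ D.a h := D.differentiableOn.differentiableAt (D.isOpen.mem_nhds hh)
  have hκ : DifferentiableAt ℝ (fun h' => (S.H (z 0)).dy (x 0, D.a h')) h := by
    unfold Ham.dy
    fun_prop
  have hm : DifferentiableAt ℝ m (D.a h) :=
    hy ▸ differentiableAt_deriv_left ((D.cycle h hh).contDiffAt_ordinate k)
  have hMm : M =ᶠ[𝓝 h] fun h' => (S.H (z 0)).dy (x 0, D.a h') * m (D.a h') := by
    filter_upwards [D.isOpen.eventually_mem hh, eventually_firstVariation_eq hh] with h' hh' hvar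
    rw [hM h' hh', hvar hh']
  have hm0 : m (D.a h) = 0 :=
    (mul_eq_zero.1 (hMm.self_of_nhds.symm.trans h0)).resolve_left
      (hy ▸ (D.cycle h hh).dy_start_ne_zero 0)
  have hderiv : deriv M h = (S.H (z 0)).dy (x 0, D.a h) * (deriv m (D.a h) * deriv D.a h) := by
    rw [(hMm.hasDerivAt_iff.2 (hκ.hasDerivAt.mul
      (hm.hasDerivAt.comp h ha.hasDerivAt))).deriv, hm0, mul_zero, zero_add]
  refine (D.cycle h hh).uniqueLimitCycleNear ?_ ?_ ?_ <;> rw [hy]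
  · exact eventually_ordinate_eq_self hh
  · exact hm0
  · rintro (hm1 : deriv m (D.a h) = 0)
    exact h1 (by rw [hderiv, hm1, zero_mul, mul_zero])

end PeriodicAnnulus

/-! ### The three annuli -/

theorem forall_zmod_two {p : ZMod 2 → Prop} (h0 : p 0) (h1 : p 1) (i : ZMod 2) : p i := by
  fin_cases i
  exacts [h0, h1]

theorem forall_zmod_four {p : ZMod 4 → Prop} (h0 : p 0) (h1 : p 1) (h2 : p 2) (h3 : p 3)
    (i : ZMod 4) : p i := by
  fin_cases i
  exacts [h0, h1, h2, h3]

theorem iUnion_zmod_two {α : Type*} (s : ZMod 2 → Set α) : ⋃ i, s i = s 0 ∪ s 1 := by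
  ext v
  simp only [mem_iUnion, mem_union]
  exact Fin.exists_fin_two

theorem iUnion_zmod_four {α : Type*} (s : ZMod 4 → Set α) :
    ⋃ i, s i = s 0 ∪ s 1 ∪ s 2 ∪ s 3 := by
  ext v
  simp only [mem_iUnion, mem_union, or_assoc]
  refine (Fin.exists_fin_succ (n := 3)).trans (or_congr_right ?_)
  exact (Fin.exists_fin_succ (n := 2)).trans (or_congr_right Fin.exists_fin_two)

variable {S : Sys}

namespace Annulus0

/-- The zones of the arcs of `L⁰_h`, starting at `A`. -/
def zones : ZMod 4 → Zone := ![Zone.R, Zone.C, Zone.L, Zone.C]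

/-- The abscissas of the vertices `A`, `A₁`, `A₂`, `A₃` of `L⁰_h`. -/
def abscissas : ZMod 4 → ℝ := ![1, 1, -1, -1]

/-- The annulus `L⁰` as a family of cycles. -/
def toPeriodicAnnulus (D : Annulus0 S) : PeriodicAnnulus S zones abscissas where
  J := D.J
  a := D.a
  isOpen := D.isOpen
  differentiableOn := D.diff
  injOn := D.inj
  cycle h hh :=
    { y := ![D.a h, D.a₁ h, D.a₂ h, D.a₃ h]
      γ := ![D.γR h, D.γB h, D.γL h, D.γC h]
      T := ![D.TR h, D.TB h, D.TL h, D.TC h]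
      cross := forall_zmod_four (D.cross h hh) (D.cross₁ h hh) (D.cross₂ h hh) (D.cross₃ h hh)
      arc := forall_zmod_four (D.arcR h hh) (D.arcB h hh) (D.arcL h hh) (D.arcC h hh) }
  cycle_y_zero _ _ := rfl

theorem orbit_cycle (D : Annulus0 S) (h : ℝ) (hh : h ∈ D.J) :
    (D.toPeriodicAnnulus.cycle h hh).orbit = D.orbit h :=
  iUnion_zmod_four _

theorem M_eq (D : Annulus0 S) (h : ℝ) (hh : h ∈ D.J) :
    D.M h = (S.H Zone.R).dy (1, D.a h) *
      (D.toPeriodicAnnulus.cycle h hh).firstVariation 4 := by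
  have hvar : (D.toPeriodicAnnulus.cycle h hh).firstVariation 4 =
      (S.lineInt Zone.C (D.γC h) (D.TC h) + (S.H Zone.C).dy (-1, D.a₃ h) *
      ((S.lineInt Zone.L (D.γL h) (D.TL h) + (S.H Zone.L).dy (-1, D.a₂ h) *
      ((S.lineInt Zone.C (D.γB h) (D.TB h) + (S.H Zone.C).dy (1, D.a₁ h) *
      ((S.lineInt Zone.R (D.γR h) (D.TR h) + (S.H Zone.R).dy (1, D.a h) * 0) /
      (S.H Zone.R).dy (1, D.a₁ h))) / (S.H Zone.C).dy (-1, D.a₂ h))) /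
      (S.H Zone.L).dy (-1, D.a₃ h))) / (S.H Zone.C).dy (1, D.a h) := rfl
  rw [hvar, M]
  ring

theorem isMelnikov (D : Annulus0 S) : Sys.IsMelnikov (S.H Zone.R) 1 S.Ret0 D.J D.a D.M :=
  D.toPeriodicAnnulus.isMelnikov (fun c q hq => ⟨c.ordinate 1 q, c.ordinate 2 q, c.ordinate 3 q,
    (hq 0 (by norm_num)).connects, (hq 1 (by norm_num)).connects, (hq 2 (by norm_num)).connects,
    (hq 3 (by norm_num)).connects⟩) D.M_eq

theorem uniqueLimitCycleNear (D : Annulus0 S) {h : ℝ} (hh : h ∈ D.J) (h0 : D.M h = 0)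
    (h1 : deriv D.M h ≠ 0) : S.UniqueLimitCycleNear (D.orbit h) :=
  D.orbit_cycle h hh ▸ PeriodicAnnulus.uniqueLimitCycleNear hh D.M_eq h0 h1

end Annulus0

namespace Annulus1

/-- The zones of the arcs of `L¹_h`, starting at `B`. -/
def zones : ZMod 2 → Zone := ![Zone.R, Zone.C]

/-- The abscissas of the vertices `B`, `B₁` of `L¹_h`. -/
def abscissas : ZMod 2 → ℝ := ![1, 1]

/-- The annulus `L¹` as a family of cycles. -/
def toPeriodicAnnulus (D : Annulus1 S) : PeriodicAnnulus S zones abscissas where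
  J := D.J
  a := D.b
  isOpen := D.isOpen
  differentiableOn := D.diff
  injOn := D.inj
  cycle h hh :=
    { y := ![D.b h, D.b₁ h]
      γ := ![D.γR h, D.γC h]
      T := ![D.TR h, D.TC h]
      cross := forall_zmod_two (D.cross h hh) (D.cross₁ h hh)
      arc := forall_zmod_two (D.arcR h hh) (D.arcC h hh) }
  cycle_y_zero _ _ := rfl

theorem orbit_cycle (D : Annulus1 S) (h : ℝ) (hh : h ∈ D.J) :
    (D.toPeriodicAnnulus.cycle h hh).orbit = D.orbit h :=
  iUnion_zmod_two _

theorem M_eq (D : Annulus1 S) (h : ℝ) (hh : h ∈ D.J) :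
    D.M h = (S.H Zone.R).dy (1, D.b h) *
      (D.toPeriodicAnnulus.cycle h hh).firstVariation 2 := by
  have hvar : (D.toPeriodicAnnulus.cycle h hh).firstVariation 2 =
      (S.lineInt Zone.C (D.γC h) (D.TC h) + (S.H Zone.C).dy (1, D.b₁ h) *
      ((S.lineInt Zone.R (D.γR h) (D.TR h) + (S.H Zone.R).dy (1, D.b h) * 0) /
      (S.H Zone.R).dy (1, D.b₁ h))) / (S.H Zone.C).dy (1, D.b h) := rfl
  rw [hvar, M]
  ring

theorem isMelnikov (D : Annulus1 S) : Sys.IsMelnikov (S.H Zone.R) 1 S.Ret1 D.J D.b D.M :=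
  D.toPeriodicAnnulus.isMelnikov (fun c q hq => ⟨c.ordinate 1 q,
    (hq 0 (by norm_num)).connects, (hq 1 (by norm_num)).connects⟩) D.M_eq

theorem uniqueLimitCycleNear (D : Annulus1 S) {h : ℝ} (hh : h ∈ D.J) (h0 : D.M h = 0)
    (h1 : deriv D.M h ≠ 0) : S.UniqueLimitCycleNear (D.orbit h) :=
  D.orbit_cycle h hh ▸ PeriodicAnnulus.uniqueLimitCycleNear hh D.M_eq h0 h1

end Annulus1

namespace Annulus2

/-- The zones of the arcs of `L²_h`, starting at `C`. -/
def zones : ZMod 2 → Zone := ![Zone.C, Zone.L]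

/-- The abscissas of the vertices `C`, `C₁` of `L²_h`. -/
def abscissas : ZMod 2 → ℝ := ![-1, -1]

/-- The annulus `L²` as a family of cycles. -/
def toPeriodicAnnulus (D : Annulus2 S) : PeriodicAnnulus S zones abscissas where
  J := D.J
  a := D.c
  isOpen := D.isOpen
  differentiableOn := D.diff
  injOn := D.inj
  cycle h hh :=
    { y := ![D.c h, D.c₁ h]
      γ := ![D.γC h, D.γL h]
      T := ![D.TC h, D.TL h]
      cross := forall_zmod_two (D.cross h hh) (D.cross₁ h hh)
      arc := forall_zmod_two (D.arcC h hh) (D.arcL h hh) }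
  cycle_y_zero _ _ := rfl

theorem orbit_cycle (D : Annulus2 S) (h : ℝ) (hh : h ∈ D.J) :
    (D.toPeriodicAnnulus.cycle h hh).orbit = D.orbit h :=
  iUnion_zmod_two _

theorem M_eq (D : Annulus2 S) (h : ℝ) (hh : h ∈ D.J) :
    D.M h = (S.H Zone.C).dy (-1, D.c h) *
      (D.toPeriodicAnnulus.cycle h hh).firstVariation 2 := by
  have hvar : (D.toPeriodicAnnulus.cycle h hh).firstVariation 2 =
      (S.lineInt Zone.L (D.γL h) (D.TL h) + (S.H Zone.L).dy (-1, D.c₁ h) *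
      ((S.lineInt Zone.C (D.γC h) (D.TC h) + (S.H Zone.C).dy (-1, D.c h) * 0) /
      (S.H Zone.C).dy (-1, D.c₁ h))) / (S.H Zone.L).dy (-1, D.c h) := rfl
  rw [hvar, M]
  ring

theorem isMelnikov (D : Annulus2 S) : Sys.IsMelnikov (S.H Zone.C) (-1) S.Ret2 D.J D.c D.M :=
  D.toPeriodicAnnulus.isMelnikov (fun c q hq => ⟨c.ordinate 1 q,
    (hq 0 (by norm_num)).connects, (hq 1 (by norm_num)).connects⟩) D.M_eq

theorem uniqueLimitCycleNear (D : Annulus2 S) {h : ℝ} (hh : h ∈ D.J) (h0 : D.M h = 0)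
    (h1 : deriv D.M h ≠ 0) : S.UniqueLimitCycleNear (D.orbit h) :=
  D.orbit_cycle h hh ▸ PeriodicAnnulus.uniqueLimitCycleNear hh D.M_eq h0 h1

end Annulus2

end PWHam

theorem theorem2_general (S : PWHam.Sys)
    (D₀ : PWHam.Annulus0 S) (D₁ : PWHam.Annulus1 S) (D₂ : PWHam.Annulus2 S) :
    (PWHam.Sys.IsMelnikov (S.H PWHam.Zone.R) 1 S.Ret0 D₀.J D₀.a D₀.M ∧
      PWHam.Sys.IsMelnikov (S.H PWHam.Zone.R) 1 S.Ret1 D₁.J D₁.b D₁.M ∧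
      PWHam.Sys.IsMelnikov (S.H PWHam.Zone.C) (-1) S.Ret2 D₂.J D₂.c D₂.M) ∧
    (∀ h ∈ D₀.J, D₀.M h = 0 → deriv D₀.M h ≠ 0 → S.UniqueLimitCycleNear (D₀.orbit h)) ∧
    (∀ h ∈ D₁.J, D₁.M h = 0 → deriv D₁.M h ≠ 0 → S.UniqueLimitCycleNear (D₁.orbit h)) ∧
    (∀ h ∈ D₂.J, D₂.M h = 0 → deriv D₂.M h ≠ 0 → S.UniqueLimitCycleNear (D₂.orbit h)) :=
  ⟨⟨D₀.isMelnikov, D₁.isMelnikov, D₂.isMelnikov⟩,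
    fun _ hh => D₀.uniqueLimitCycleNear hh, fun _ hh => D₁.uniqueLimitCycleNear hh,
    fun _ hh => D₂.uniqueLimitCycleNear hh⟩

theorem theorem2 (S : PWHam.Sys) (h1 : S.H1) (h2 : S.H2)
    (D₀ : PWHam.Annulus0 S) (D₁ : PWHam.Annulus1 S) (D₂ : PWHam.Annulus2 S) :
    (PWHam.Sys.IsMelnikov (S.H PWHam.Zone.R) 1 S.Ret0 D₀.J D₀.a D₀.M ∧
      PWHam.Sys.IsMelnikov (S.H PWHam.Zone.R) 1 S.Ret1 D₁.J D₁.b D₁.M ∧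
      PWHam.Sys.IsMelnikov (S.H PWHam.Zone.C) (-1) S.Ret2 D₂.J D₂.c D₂.M) ∧
    (∀ h ∈ D₀.J, D₀.M h = 0 → deriv D₀.M h ≠ 0 → S.UniqueLimitCycleNear (D₀.orbit h)) ∧
    (∀ h ∈ D₁.J, D₁.M h = 0 → deriv D₁.M h ≠ 0 → S.UniqueLimitCycleNear (D₁.orbit h)) ∧
    (∀ h ∈ D₂.J, D₂.M h = 0 → deriv D₂.M h ≠ 0 → S.UniqueLimitCycleNear (D₂.orbit h)) :=
  theorem2_general S D₀ D₁ D₂
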